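/- **Setting.** Let $d,K\ge 1$ and $N\ge 0$ be integers, and let $L\ge 0$, $0<\sigma\le B$, $D,P,\sigma_z>0$; put $\mathtt{SNR}=KP/\sigma_z^2$. Let $\mathbb X$ be the family of nonempty compact convex sets $\mathcal X\subset\mathbb R^d$ with $\sup_{x,y\in\mathcal X}\|x-y\|\le D$ (Euclidean norm). *Problems.* For $\mathcal X\in\mathbb X$ let $\mathcal O$ be the set of pairs $(f,\mathcal C)$, where $f$ is differentiable at the points of $\mathcal X$, convex on $\mathcal X$, and satisfies $f(y)-f(x)\le\nabla f(x)^\top(y-x)+\frac L2\|y-x\|^2$ for $x,y\in\mathcal X$, and $\mathcal C$ consists of $K$ clients which, queried at $x\in\mathcal X$, return random vectors $\hat g_k(x)$ (drawn independently over clients and queries) with $\mathbb E\,\hat g_k(x)=\nabla f(x)$, $\mathbb E\|\hat g_k(x)-\nabla f(x)\|^2\le\sigma^2$ and $\|\hat g_k(x)\|\le B$ almost surely. *Analog protocols.* An analog scheme of length $\ell\le d$ consists of linear encoders $\varphi_k(x,U)=\mathbf A_k(U)x$, $\mathbf A_k(U)\in\mathbb R^{\ell\times d}$, $k=1,\dots,K$,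 where $U$ is public randomness, and a decoder $\psi:\mathbb R^\ell\times\mathcal U\to\mathbb R^d$. The encoders must satisfy $\mathbb E\|\varphi_k(\hat g,U)\|^2\le\ell P$ for every random vector $\hat g$ independent of $U$ with $\|\hat g\|\le B$ a.s. and $\mathbb E\|\hat g-\mathbb E\hat g\|^2\le\sigma^2$. In round $t=1,\dots,T$ a (possibly randomized) algorithm $\pi$ chooses a query point $x_t\in\mathcal X$ from the previously decoded estimates and query points. The server receives $Y_t=\sum_{k}\varphi_k(\hat g_{k}(x_t),U_t)+Z_t$ with independent $Z_t\sim\mathcal N(0,\sigma_z^2 I_\ell)$, where $U_t$ is the public randomness used in round $t$, and decodes $\psi(Y_t,U_t)$. After $T$ rounds $\pi$ outputs a point $\bar x_T\in\mathcal X$ computed from the decoded estimates. Define $$\mathcal E^\ast_{\tt analog}(N,K,\mathtt{SNR})=\sup_{\mathcal X\in\mathbb X}\ \inf_{T\ell\le N}\ \sup_{(f,\mathcal C)\in\mathcal O}\Big(\mathbb E f(\bar x_T)-\min_{\mathcal X}f\Big),$$ where the infimum is over all lengths $\ell$, numbers of rounds $T$ with $T\ell\le N$, analog schemes of length $\ell$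 and algorithms with $T$ queries. **Theorem 5.1.** There is a universal constant $c\in(0,1)$ such that for all parameters as above, whenever $$N\ \ge\ \frac{d}{K}\cdot\frac{1}{B^2}\Big(\sigma^2+\frac{\sigma^2}{\mathtt{SNR}}\Big),$$ we have $$\mathcal E^\ast_{\tt analog}(N,K,\mathtt{SNR})\ \ge\ \frac{cD}{\sqrt{KN}}\sqrt{d\sigma^2+\frac{d\sigma^2}{\mathtt{SNR}}}.$$ In particular $\mathcal E^\ast_{\tt analog}(N,K,\mathtt{SNR})\ge\sqrt d\cdot\frac{cD\sigma}{\sqrt{KN}}$ for every value of $\mathtt{SNR}$, which is $\sqrt d$ times the centralized rate $D\sigma/\sqrt{KN}$ up to a constant. -/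

import Mathlib

open MeasureTheory ProbabilityTheory
open scoped ENNReal

namespace OTA

/-- `ℝ^n` with the Euclidean norm. -/
abbrev Vec (n : ℕ) : Type := EuclideanSpace ℝ (Fin n)

/-- The admissible domains: nonempty compact convex sets whose diameter is at most `D`. -/
structure IsAdmissibleDomain {d : ℕ} (D : ℝ) (X : Set (Vec d)) : Prop where
  nonempty : X.Nonempty
  convex : Convex ℝ X
  isCompact : IsCompact X
  dist_le : ∀ x ∈ X, ∀ y ∈ X, dist x y ≤ D

/-- A pair of an objective function `f` and `K` clients.
At a query point `x` client `k` returns `g k x ω`, where `ω` is drawn from the probability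
space `(Seed, μ)`; independent seeds are used for different clients and different queries. -/
structure Problem (d K : ℕ) (L σ B : ℝ) (X : Set (Vec d)) : Type 1 where
  f : Vec d → ℝ
  differentiableAt : ∀ x ∈ X, DifferentiableAt ℝ f x
  convexOn : ConvexOn ℝ X f
  smooth : ∀ x ∈ X, ∀ y ∈ X,
    f y - f x ≤ inner ℝ (gradient f x) (y - x) + L / 2 * ‖y - x‖ ^ 2
  Seed : Type
  [measurableSpaceSeed : MeasurableSpace Seed]
  μ : Measure Seed
  [isProbabilityMeasure : IsProbabilityMeasure μ]
  g : Fin K → Vec d → Seed → Vec d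
  measurable_g : ∀ k, Measurable (fun p : Vec d × Seed => g k p.1 p.2)
  unbiased : ∀ k, ∀ x ∈ X, ∫ ω, g k x ω ∂μ = gradient f x
  deviation : ∀ k, ∀ x ∈ X, ∫ ω, ‖g k x ω - gradient f x‖ ^ 2 ∂μ ≤ σ ^ 2
  bounded : ∀ k, ∀ x ∈ X, ∀ᵐ ω ∂μ, ‖g k x ω‖ ^ 2 ≤ B ^ 2

attribute [instance] Problem.measurableSpaceSeed Problem.isProbabilityMeasure

/-- The laws that a gradient estimate can have: bounded by `B` almost surely, with mean square
deviation from the mean at most `σ ^ 2`. -/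
structure IsEstimateLaw {d : ℕ} (σ B : ℝ) (η : Measure (Vec d)) : Prop where
  isProbabilityMeasure : IsProbabilityMeasure η
  bounded : ∀ᵐ x ∂η, ‖x‖ ^ 2 ≤ B ^ 2
  deviation : ∫ x, ‖x - ∫ y, y ∂η‖ ^ 2 ∂η ≤ σ ^ 2

/-- A communication scheme of length `ℓ` for `K` clients with average power `P`.
The public randomness is a stream `u : ℕ → U` with law `ν`, known to all encoders and to the
decoder, and `u t` is used in round `t`. The law `ν` is arbitrary: an i.i.d. stream is fresh
public randomness in every round, a constant stream is one random string for the whole run.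
The power constraint is required for every gradient estimate that can occur. -/
structure CommScheme (d K ℓ : ℕ) (P σ B : ℝ) : Type 1 where
  U : Type
  [measurableSpaceU : MeasurableSpace U]
  ν : Measure (ℕ → U)
  [isProbabilityMeasure : IsProbabilityMeasure ν]
  φ : Fin K → Vec d → U → Vec ℓ
  measurable_φ : ∀ k, Measurable (fun p : Vec d × U => φ k p.1 p.2)
  power : ∀ (k : Fin K) (t : ℕ) (η : Measure (Vec d)), IsEstimateLaw σ B η →
    ∫⁻ p, ENNReal.ofReal (‖φ k p.1 (p.2 t)‖ ^ 2) ∂(η.prod ν) ≤ ENNReal.ofReal (ℓ * P)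
  ψ : Vec ℓ → U → Vec d
  measurable_ψ : Measurable (fun p : Vec ℓ × U => ψ p.1 p.2)

attribute [instance] CommScheme.measurableSpaceU CommScheme.isProbabilityMeasure

/-- A scheme is analog if `ℓ ≤ d` and every encoder is `x ↦ A x` for an `ℓ × d` matrix `A`, which
may depend on the client and on the public randomness but not on `x`. -/
def CommScheme.IsAnalog {d K ℓ : ℕ} {P σ B : ℝ} (Q : CommScheme d K ℓ P σ B) : Prop :=
  ℓ ≤ d ∧ ∃ A : Fin K → Q.U → Matrix (Fin ℓ) (Fin d) ℝ,
    ∀ k x u, Q.φ k x u = WithLp.toLp 2 ((A k u).mulVec x.ofLp)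

/-- A (possibly randomized) first-order algorithm on `X` making `T` queries. The query point of
round `t` is a function of the internal random seed and of the `t` earlier decoded estimates
(the earlier query points are themselves functions of these), and so is the final output. -/
structure Algorithm (d T : ℕ) (X : Set (Vec d)) : Type 1 where
  W : Type
  [measurableSpaceW : MeasurableSpace W]
  ρ : Measure W
  [isProbabilityMeasure : IsProbabilityMeasure ρ]
  query : (t : ℕ) → W → (Fin t → Vec d) → Vec d
  measurable_query : ∀ t, Measurable (fun p : W × (Fin t → Vec d) => query t p.1 p.2)
  query_mem : ∀ t w h, query t w h ∈ X
  output : W → (Fin T → Vec d) → Vec d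
  measurable_output : Measurable (fun p : W × (Fin T → Vec d) => output p.1 p.2)
  output_mem : ∀ w h, output w h ∈ X

attribute [instance] Algorithm.measurableSpaceW Algorithm.isProbabilityMeasure

section Run

variable {d K ℓ T : ℕ} {L P σ B : ℝ} {X : Set (Vec d)}

/-- The output `Y` of the multiple access channel in a round with query point `x`, client seeds
`ω`, public randomness `u` and channel noise `z`. -/
noncomputable def channelOutput (I : Problem d K L σ B X) (Q : CommScheme d K ℓ P σ B)
    (x : Vec d) (u : Q.U) (ω : Fin K → I.Seed) (z : Fin ℓ → ℝ) : Vec ℓ :=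
  WithLp.toLp 2 fun j => (∑ k, Q.φ k (I.g k x (ω k)) u j) + z j

/-- The list of estimates decoded in the first `t` rounds, as a function of all the
randomness of these rounds. -/
noncomputable def decoded (I : Problem d K L σ B X) (Q : CommScheme d K ℓ P σ B)
    (π : Algorithm d T X) (w : π.W) :
    (t : ℕ) → (Fin t → Q.U) → (Fin t → Fin K → I.Seed) → (Fin t → Fin ℓ → ℝ) → Fin t → Vec d
  | 0, _, _, _ => Fin.elim0
  | t + 1, u, ω, z =>
    let past : Fin t → Vec d :=
      decoded I Q π w t (fun i => u i.castSucc) (fun i => ω i.castSucc) (fun i => z i.castSucc)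
    Fin.snoc (α := fun _ => Vec d) past
      (Q.ψ (channelOutput I Q (π.query t w past) (u (Fin.last t)) (ω (Fin.last t))
        (z (Fin.last t))) (u (Fin.last t)))

/-- The convergence error `E[f(output)] - min_X f` of a protocol. The algorithm's seed, the public
randomness, the seeds of the clients and the channel noise (i.i.d. centred Gaussian with
variance `σz ^ 2`) are independent. As the output lies in `X`, the quantity averaged here is
nonnegative. -/
noncomputable def convergenceError (σz : ℝ) (I : Problem d K L σ B X)
    (Q : CommScheme d K ℓ P σ B) (π : Algorithm d T X) : ℝ≥0∞ :=
  ∫⁻ s : π.W × (ℕ → Q.U) × (Fin T → Fin K → I.Seed) × (Fin T → Fin ℓ → ℝ),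
    ENNReal.ofReal
      (I.f (π.output s.1 (decoded I Q π s.1 T (fun t => s.2.1 t) s.2.2.1 s.2.2.2))
        - sInf (I.f '' X))
    ∂(π.ρ.prod (Q.ν.prod
      ((Measure.pi fun _ : Fin T => Measure.pi fun _ : Fin K => I.μ).prod
        (Measure.pi fun _ : Fin T => Measure.pi fun _ : Fin ℓ =>
          gaussianReal 0 (Real.toNNReal (σz ^ 2))))))

end Run

/-- The minimax error of analog schemes on a fixed domain `X`, with at most `N` channel uses. -/
noncomputable def analogErrorOn (d K N : ℕ) (L σ B P σz : ℝ) (X : Set (Vec d)) : ℝ≥0∞ :=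
  ⨅ (ℓ : ℕ) (T : ℕ) (_ : T * ℓ ≤ N) (Q : CommScheme d K ℓ P σ B) (_ : Q.IsAnalog)
    (π : Algorithm d T X), ⨆ I : Problem d K L σ B X, convergenceError σz I Q π

/-- The minimax error of analog schemes: the supremum over all admissible domains. -/
noncomputable def analogMinimaxError (d K N : ℕ) (L σ B D P σz : ℝ) : ℝ≥0∞ :=
  ⨆ (X : Set (Vec d)) (_ : IsAdmissibleDomain D X), analogErrorOn d K N L σ B P σz X

/-- The signal-to-noise ratio. -/
noncomputable def snr (K : ℕ) (P σz : ℝ) : ℝ := K * P / σz ^ 2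

end OTA

/-!
The hard objectives are the linear functions `⟨v, ·⟩` on a cube, whose gradients `v` are the
vertices `(±δ, …, ±δ)` of a small cube, and the clients return `v` plus noise that does not depend
on the query point. Adaptivity is then worthless: the server sees `T` independent noisy linear
images of `v`, and minimizing the objective means finding most of the signs. By Assouad's lemma
(`exists_le_convergenceError`) the error is of order `δ D √d` as long as flipping a sign is hidden,
on average over the signs, by the noise.

Flipping the sign `i` adds `2 δ eᵢ` to `v`. As the encoders are linear, the server cannot
distinguish this from certain translations of the noise (`received_shift`), so that it is enough to
compare the law of the noise with a translate. For a product measure this is done with Hellinger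
affinities, whose defects are quadratic in the translation and add up over the coordinates
(`ShiftAffinity.pi`, `ShiftAffinity.shiftTesting`). There are two ways to choose the noise.

* The clients add noise with independent coordinates of size `σ / (2 √d)`, bounded and with a
  density whose square root is Lipschitz (`tentLaw`). In one round the vector of all clients'
  estimates is observed through `ℓ` linear functionals, so that only the projection of the
  translation to a space of dimension at most `ℓ` matters (`exists_equivalent_shifts`). Averaged
  over `i`, the defect is of order `(d δ² / σ²) · (K ℓ / d)` per round, which permits
  `δ² ~ σ² / (K N)`. This uses neither the power constraint nor the channel noise.
* The clients return `v` exactly. The power constraint, applied to the constant estimates `σ eᵢ`,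
  bounds the columns of the encoding matrices, hence the translation of the Gaussian channel noise,
  and permits `δ² ~ σ² / (K N SNR)`.

The larger of the two bounds is the claim up to a constant, and the lower bound on `N` is what
makes `‖v‖ = δ √d` a fraction of `B`.
-/

namespace OTA

open scoped NNReal

/-! ### Testing a probability measure against its translates -/

/-- Tonelli's theorem for products of functions of one coordinate each. -/
theorem lintegral_fin_prod {E : Type*} [MeasurableSpace E] (ν : Measure E) [SigmaFinite ν] :
    ∀ {n : ℕ} (f : Fin n → E → ℝ≥0∞), (∀ i, Measurable (f i)) →
      ∫⁻ x : Fin n → E, ∏ i, f i (x i) ∂(Measure.pi fun _ => ν) = ∏ i, ∫⁻ x, f i x ∂ν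
  | 0, f, _ => by simp
  | n + 1, f, hf => by
    have hm : Measurable fun x : Fin n → E => ∏ i : Fin n, f i.succ (x i) :=
      Finset.measurable_fun_prod _ fun i _ => (hf i.succ).comp (measurable_pi_apply i)
    have hsplit : ∀ p : E × (Fin n → E),
        ∏ i, f i ((MeasurableEquiv.piFinSuccAbove (fun _ : Fin (n + 1) => E) 0).symm p i)
          = f 0 p.1 * ∏ i : Fin n, f i.succ (p.2 i) := fun p => by
      rw [Fin.prod_univ_succ]; rfl
    rw [← (measurePreserving_piFinSuccAbove (fun _ : Fin (n + 1) => ν) 0).symm.lintegral_comp_emb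
      (MeasurableEquiv.measurableEmbedding _)]
    simp_rw [hsplit]
    rw [lintegral_prod_mul (hf 0).aemeasurable hm.aemeasurable, Fin.prod_univ_succ,
      lintegral_fin_prod ν (fun i => f i.succ) fun i => hf i.succ]

theorem pi_withDensity {E : Type*} [MeasurableSpace E] (ν : Measure E) [SigmaFinite ν]
    {n : ℕ} (p : E → ℝ≥0∞) (hp : Measurable p) [SigmaFinite (ν.withDensity p)] :
    Measure.pi (fun _ : Fin n => ν.withDensity p)
      = (Measure.pi fun _ : Fin n => ν).withDensity fun x => ∏ i, p (x i) := by
  refine Measure.pi_eq fun s hs => ?_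
  rw [withDensity_apply _ (MeasurableSet.univ_pi hs),
    ← lintegral_indicator (MeasurableSet.univ_pi hs)]
  have : ∀ x : Fin n → E, (Set.univ.pi s).indicator (fun x => ∏ i, p (x i)) x
      = ∏ i, (s i).indicator p (x i) := by
    intro x
    by_cases hx : x ∈ Set.univ.pi s
    · rw [Set.indicator_of_mem hx]
      exact Finset.prod_congr rfl fun i _ => (Set.indicator_of_mem (hx i trivial) p).symm
    · rw [Set.indicator_of_notMem hx]
      obtain ⟨i, hi⟩ : ∃ i, x i ∉ s i := by simpa using hx
      exact (Finset.prod_eq_zero (Finset.mem_univ i) (Set.indicator_of_notMem hi p)).symm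
  simp_rw [this]
  rw [lintegral_fin_prod ν _ fun i => hp.indicator (hs i)]
  exact Finset.prod_congr rfl fun i _ => by
    rw [lintegral_indicator (hs i), withDensity_apply _ (hs i)]

theorem one_sub_sum_le_prod {ι : Type*} (s : Finset ι) (κ : ι → ℝ≥0∞) :
    1 - ∑ i ∈ s, κ i ≤ ∏ i ∈ s, (1 - κ i) := by
  classical
  induction s using Finset.induction_on with
  | empty => simp
  | insert i s hi ih =>
    rw [Finset.sum_insert hi, Finset.prod_insert hi]
    refine le_trans ?_ (mul_le_mul' le_rfl ih)
    set a := κ i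
    set b := ∑ j ∈ s, κ j
    rw [tsub_le_iff_right]
    rcases le_total 1 a with ha | ha
    · exact ha.trans (le_add_left le_self_add)
    · calc (1 : ℝ≥0∞) = (1 - a) * 1 + a := by rw [mul_one, tsub_add_cancel_of_le ha]
        _ ≤ (1 - a) * ((1 - b) + b) + a := by gcongr; exact le_tsub_add
        _ = (1 - a) * (1 - b) + (1 - a) * b + a := by ring
        _ ≤ (1 - a) * (1 - b) + 1 * b + a := by gcongr; exact tsub_le_self
        _ = (1 - a) * (1 - b) + (a + b) := by ring

/-- `μ` has a density `q ^ 2` with respect to the volume, and the Hellinger affinity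
`∫ q (x) q (x + a) dx` of `μ` and its translate by `a` is at least `1 - κ a`. -/
def ShiftAffinity {E : Type*} [MeasureSpace E] [Add E] (μ : Measure E) (κ : E → ℝ≥0∞) : Prop :=
  ∃ q : E → ℝ≥0, Measurable q ∧ μ = volume.withDensity (fun x => (q x : ℝ≥0∞) ^ 2) ∧
    ∀ a, 1 - κ a ≤ ∫⁻ x, (q x : ℝ≥0∞) * q (x + a)

/-- Hellinger affinities of product measures multiply, so that the defects add up. -/
theorem ShiftAffinity.pi {E : Type*} [MeasureSpace E] [Add E] [MeasurableAdd E]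
    [SigmaFinite (volume : Measure E)]
    {μ : Measure E} [SigmaFinite μ] {κ : E → ℝ≥0∞} (h : ShiftAffinity μ κ) (n : ℕ) :
    ShiftAffinity (Measure.pi fun _ : Fin n => μ) fun a => ∑ i, κ (a i) := by
  obtain ⟨q, hq, rfl, hκ⟩ := h
  have hq' : Measurable fun x => (q x : ℝ≥0∞) := hq.coe_nnreal_ennreal
  refine ⟨fun x => ∏ i, q (x i),
    Finset.measurable_fun_prod _ fun i _ => hq.comp (measurable_pi_apply i), ?_, fun a => ?_⟩
  · rw [pi_withDensity _ _ (hq'.pow_const 2)]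
    simp_rw [Finset.prod_pow, ENNReal.ofNNReal_finsetProd]
    rfl
  · simp_rw [ENNReal.ofNNReal_finsetProd, ← Finset.prod_mul_distrib]
    rw [show (volume : Measure (Fin n → E)) = Measure.pi fun _ => volume from rfl]
    have := lintegral_fin_prod (volume : Measure E)
      (fun i x => (q x : ℝ≥0∞) * q (x + a i))
      (fun i : Fin n => hq'.mul (hq'.comp (measurable_add_const (a i))))
    refine ((one_sub_sum_le_prod _ _).trans ?_).trans this.ge
    exact Finset.prod_le_prod' fun i _ => hκ (a i)

/-- Testing `μ` against its translate by `a`: the two error probabilities of any randomized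
test `h₁ + h₂ = 1` add up to at least `1 / 2 - κ`. -/
def ShiftTesting {E : Type*} [MeasurableSpace E] [Add E] (μ : Measure E) (a : E) (κ : ℝ≥0∞) :
    Prop :=
  ∀ h₁ h₂ : E → ℝ≥0∞, Measurable h₁ → Measurable h₂ → (∀ x, h₁ x + h₂ x = 1) →
    1 / 2 - κ ≤ ∫⁻ x, h₁ x ∂μ + ∫⁻ x, h₂ (x + a) ∂μ

theorem ennreal_mul_le_sq_add (x y : ℝ≥0) :
    (x : ℝ≥0∞) * y ≤ (x : ℝ≥0∞) ^ 2 + (y : ℝ≥0∞) ^ 2 / 4 := by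
  have : x * y ≤ x ^ 2 + y ^ 2 / 4 := by
    rw [← NNReal.coe_le_coe]
    push_cast
    nlinarith [sq_nonneg ((x : ℝ) - y / 2)]
  have h2 := ENNReal.coe_le_coe.2 this
  rw [ENNReal.coe_add, ENNReal.coe_div (by norm_num)] at h2
  simpa using h2

/-- Le Cam's two-point bound, in a form that is linear in `κ`. With `r x = q (x + a)`, the
affinity `∫ q r` is bounded by means of `q r ≤ r² + q² / 4` with weight `h₁` and of
`q r ≤ q² + r² / 4` with weight `h₂`. -/
theorem ShiftAffinity.shiftTesting {E : Type*} [MeasureSpace E] [AddGroup E] [MeasurableAdd E]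
    [(volume : Measure E).IsAddRightInvariant]
    {μ : Measure E} [IsProbabilityMeasure μ] {κ : E → ℝ≥0∞} (h : ShiftAffinity μ κ) (a : E) :
    ShiftTesting μ a (κ a) := by
  intro h₁ h₂ m₁ m₂ h12
  obtain ⟨q, hq, hμ, hκ⟩ := h
  have hq' : Measurable fun x => (q x : ℝ≥0∞) := hq.coe_nnreal_ennreal
  have hqa : Measurable fun x => (q (x + a) : ℝ≥0∞) := hq'.comp (measurable_add_const a)
  have m₂a : Measurable fun x => h₂ (x + a) := m₂.comp (measurable_add_const a)
  have hone : ∫⁻ x, (q x : ℝ≥0∞) ^ 2 = 1 := by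
    have := measure_univ (μ := μ)
    rwa [hμ, withDensity_apply _ MeasurableSet.univ, Measure.restrict_univ] at this
  have hle : ∀ (f : E → ℝ≥0∞), Measurable f → ∫⁻ x, f x ∂μ = ∫⁻ x, (q x : ℝ≥0∞) ^ 2 * f x := by
    intro f hf
    rw [hμ, lintegral_withDensity_eq_lintegral_mul _ (hq'.pow_const 2) hf]
    rfl
  have hl1 : ∀ x, h₁ x ≤ 1 := fun x => h12 x ▸ le_self_add
  have hl2 : ∀ x, h₂ x ≤ 1 := fun x => h12 x ▸ le_add_self
  rw [hle _ m₁, hle _ m₂a]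
  set X := ∫⁻ x, (q x : ℝ≥0∞) ^ 2 * h₁ x
  set Y := ∫⁻ x, (q x : ℝ≥0∞) ^ 2 * h₂ (x + a)
  have key : 1 - κ a ≤ (X + 1 / 4) + (Y + 1 / 4) := by
    refine (hκ a).trans ?_
    have hpt : ∀ x, (q x : ℝ≥0∞) * q (x + a)
        ≤ ((q (x + a) : ℝ≥0∞) ^ 2 * h₁ (x + a) + (q x : ℝ≥0∞) ^ 2 / 4)
          + ((q x : ℝ≥0∞) ^ 2 * h₂ (x + a) + (q (x + a) : ℝ≥0∞) ^ 2 / 4) := by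
      intro x
      have e1 := ennreal_mul_le_sq_add (q (x + a)) (q x)
      have e2 := ennreal_mul_le_sq_add (q x) (q (x + a))
      rw [mul_comm] at e1
      calc (q x : ℝ≥0∞) * q (x + a)
          = h₁ (x + a) * ((q x : ℝ≥0∞) * q (x + a))
            + h₂ (x + a) * ((q x : ℝ≥0∞) * q (x + a)) := by rw [← add_mul, h12, one_mul]
        _ ≤ h₁ (x + a) * ((q (x + a) : ℝ≥0∞) ^ 2 + (q x : ℝ≥0∞) ^ 2 / 4)
            + h₂ (x + a) * ((q x : ℝ≥0∞) ^ 2 + (q (x + a) : ℝ≥0∞) ^ 2 / 4) := by gcongr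
        _ = ((q (x + a) : ℝ≥0∞) ^ 2 * h₁ (x + a) + h₁ (x + a) * ((q x : ℝ≥0∞) ^ 2 / 4))
          + ((q x : ℝ≥0∞) ^ 2 * h₂ (x + a) + h₂ (x + a) * ((q (x + a) : ℝ≥0∞) ^ 2 / 4)) := by
            ring
        _ ≤ _ := by
          gcongr
          · exact mul_le_of_le_one_left' (hl1 _)
          · exact mul_le_of_le_one_left' (hl2 _)
    refine (lintegral_mono hpt).trans (le_of_eq ?_)
    have mX : Measurable fun x => (q x : ℝ≥0∞) ^ 2 * h₁ x := (hq'.pow_const 2).mul m₁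
    have mX' : Measurable fun x => (q (x + a) : ℝ≥0∞) ^ 2 * h₁ (x + a) :=
      mX.comp (measurable_add_const a)
    have mY : Measurable fun x => (q x : ℝ≥0∞) ^ 2 * h₂ (x + a) := (hq'.pow_const 2).mul m₂a
    have mq : Measurable fun x => (q x : ℝ≥0∞) ^ 2 / 4 := (hq'.pow_const 2).div_const 4
    have mXq : Measurable fun x =>
        (q (x + a) : ℝ≥0∞) ^ 2 * h₁ (x + a) + (q x : ℝ≥0∞) ^ 2 / 4 := mX'.add mq
    rw [lintegral_add_left mXq, lintegral_add_left mX', lintegral_add_left mY,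
      lintegral_add_right_eq_self (fun x => (q x : ℝ≥0∞) ^ 2 * h₁ x) a,
      lintegral_add_right_eq_self (fun x => (q x : ℝ≥0∞) ^ 2 / 4) a]
    simp_rw [div_eq_mul_inv]
    rw [lintegral_mul_const _ (hq'.pow_const 2), hone]
  rw [tsub_le_iff_right] at key ⊢
  have h4 : (1 : ℝ≥0∞) = 1 / 2 + 1 / 2 := (ENNReal.add_halves 1).symm
  have h5 : (1 / 4 : ℝ≥0∞) + 1 / 4 = 1 / 2 := by
    rw [show (4 : ℝ≥0∞) = 2 * 2 by norm_num, one_div, one_div,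
      ENNReal.mul_inv (by simp) (by simp), ← mul_add, ENNReal.inv_two_add_inv_two, mul_one]
  have h6 : (1 / 2 : ℝ≥0∞) + 1 / 2 ≤ (X + Y + κ a) + 1 / 2 := by
    rw [← h4]
    refine key.trans (le_of_eq ?_)
    rw [← h5]; ring
  exact (ENNReal.add_le_add_iff_right (by simp)).1 h6

theorem ShiftTesting.prod_left {E F : Type*} [MeasurableSpace E] [Add E] [MeasurableAdd E]
    [MeasurableSpace F] [AddZeroClass F] {μ : Measure E} [SFinite μ] {ν : Measure F}
    [IsProbabilityMeasure ν] {a : E} {κ : ℝ≥0∞} (h : ShiftTesting μ a κ) :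
    ShiftTesting (μ.prod ν) (a, 0) κ := by
  intro h₁ h₂ m₁ m₂ h12
  have hs : Measurable fun x : E × F => h₂ (x + (a, 0)) := by
    have : (fun x : E × F => h₂ (x + (a, 0))) = fun x => h₂ (x.1 + a, x.2) := by
      ext x; congr 1; ext <;> simp
    rw [this]
    exact m₂.comp (((measurable_add_const a).comp measurable_fst).prodMk measurable_snd)
  rw [lintegral_prod_symm _ m₁.aemeasurable, lintegral_prod_symm _ hs.aemeasurable,
    ← lintegral_add_left m₁.lintegral_prod_left']
  calc 1 / 2 - κ = ∫⁻ _ : F, (1 / 2 - κ) ∂ν := by simp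
    _ ≤ _ := lintegral_mono fun y => by
      have := h (fun x => h₁ (x, y)) (fun x => h₂ (x, y)) (m₁.comp measurable_prodMk_right)
        (m₂.comp measurable_prodMk_right) fun x => h12 _
      simpa using this

theorem ShiftTesting.prod_right {E F : Type*} [MeasurableSpace E] [AddZeroClass E]
    [MeasurableSpace F] [Add F] [MeasurableAdd F] {μ : Measure E} [IsProbabilityMeasure μ]
    {ν : Measure F} [SFinite ν] {b : F} {κ : ℝ≥0∞} (h : ShiftTesting ν b κ) :
    ShiftTesting (μ.prod ν) (0, b) κ := by
  intro h₁ h₂ m₁ m₂ h12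
  have hs : Measurable fun x : E × F => h₂ (x + (0, b)) := by
    have : (fun x : E × F => h₂ (x + (0, b))) = fun x => h₂ (x.1, x.2 + b) := by
      ext x; congr 1; ext <;> simp
    rw [this]
    exact m₂.comp (measurable_fst.prodMk ((measurable_add_const b).comp measurable_snd))
  rw [lintegral_prod _ m₁.aemeasurable, lintegral_prod _ hs.aemeasurable,
    ← lintegral_add_left m₁.lintegral_prod_right']
  calc 1 / 2 - κ = ∫⁻ _ : E, (1 / 2 - κ) ∂μ := by simp
    _ ≤ _ := lintegral_mono fun y => by
      have := h (fun x => h₁ (y, x)) (fun x => h₂ (y, x)) (m₁.comp measurable_prodMk_left)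
        (m₂.comp measurable_prodMk_left) fun x => h12 _
      simpa using this

/-! ### Two noise laws: the squared tent and the Gaussian -/

/-- The tent function `max 0 (1 - |x|)`. -/
noncomputable def tent (x : ℝ) : ℝ := max 0 (1 - |x|)

theorem tent_nonneg (x : ℝ) : 0 ≤ tent x := le_max_left _ _

theorem continuous_tent : Continuous tent := by unfold tent; fun_prop

theorem tent_eq_zero {x : ℝ} (hx : x ∉ Set.Icc (-1 : ℝ) 1) : tent x = 0 := by
  refine max_eq_left ?_
  have : ¬ |x| ≤ 1 := fun h => hx (abs_le.1 h)
  linarith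

theorem abs_tent_sub_le (x y : ℝ) : |tent x - tent y| ≤ |x - y| := by
  unfold tent
  refine (abs_max_sub_max_le_max _ _ _ _).trans ?_
  rw [sub_self, abs_zero, max_eq_right (abs_nonneg _), show 1 - |x| - (1 - |y|) = |y| - |x| by ring,
    abs_sub_comm x y]
  exact abs_abs_sub_abs_le_abs_sub _ _

theorem integrable_tent_sq : Integrable fun x => tent x ^ 2 := by
  refine Continuous.integrable_of_hasCompactSupport (continuous_tent.pow 2) ?_
  exact HasCompactSupport.intro (isCompact_Icc (a := (-1 : ℝ)) (b := 1))
    fun x hx => by simp [tent_eq_zero hx]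

theorem integral_tent_sq : ∫ x, tent x ^ 2 = 2 / 3 := by
  have h1 : ∫ x, tent x ^ 2 = ∫ x, (fun y : ℝ => max 0 (1 - y) ^ 2) |x| := rfl
  rw [h1, integral_comp_abs (f := fun y : ℝ => max 0 (1 - y) ^ 2),
    setIntegral_eq_of_subset_of_forall_sdiff_eq_zero (s := Set.Ioc 0 1) measurableSet_Ioi
      Set.Ioc_subset_Ioi_self, ← intervalIntegral.integral_of_le zero_le_one]
  · have : ∫ x in (0 : ℝ)..1, max 0 (1 - x) ^ 2 = ∫ x in (0 : ℝ)..1, (1 - x) ^ 2 := by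
      refine intervalIntegral.integral_congr fun x hx => ?_
      rw [Set.uIcc_of_le zero_le_one] at hx
      rw [max_eq_right (by linarith [hx.2])]
    rw [this, intervalIntegral.integral_comp_sub_left (fun x : ℝ => x ^ 2) 1]
    norm_num
  · intro x hx
    have : 1 < x := by
      by_contra h
      exact hx.2 ⟨hx.1, not_lt.1 h⟩
    rw [max_eq_left (by linarith)]; norm_num

/-- The affinity of the tent with its translates. Polarization reduces it to
`∫ (tent x - tent (x + a)) ^ 2`, and the tent is `1`-Lipschitz with support of length `2`. -/
theorem integral_tent_mul_tent_ge (a : ℝ) :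
    2 / 3 - 2 * a ^ 2 ≤ ∫ x, tent x * tent (x + a) := by
  let ψ : ℝ → ℝ := fun x =>
    1 / 2 * tent x ^ 2 - 1 / 2 * (Set.Icc (-1 : ℝ) 1).indicator (fun _ => a ^ 2) x
  have i1 : Integrable fun x => 1 / 2 * tent x ^ 2 := integrable_tent_sq.const_mul _
  have i2 : Integrable fun x => 1 / 2 * (Set.Icc (-1 : ℝ) 1).indicator (fun _ => a ^ 2) x :=
    ((integrable_indicator_iff measurableSet_Icc).2 (by simp)).const_mul _
  have hψi : Integrable ψ := i1.sub i2
  have hψ : ∫ x, ψ x = 1 / 3 - a ^ 2 := by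
    rw [integral_sub i1 i2, integral_const_mul, integral_const_mul, integral_tent_sq,
      integral_indicator measurableSet_Icc]
    simp only [integral_const, measureReal_restrict_apply_univ, Real.volume_real_Icc, smul_eq_mul]
    norm_num
    ring
  have hψa : Integrable fun x => ψ (x + a) := hψi.comp_add_right a
  have hsum : ∫ x, (ψ x + ψ (x + a)) = 2 / 3 - 2 * a ^ 2 := by
    rw [integral_add hψi hψa, integral_add_right_eq_self ψ a, hψ]; ring
  rw [← hsum]
  refine integral_mono (hψi.add hψa) ?_ fun x => ?_
  · refine Continuous.integrable_of_hasCompactSupport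
      (continuous_tent.mul (continuous_tent.comp (continuous_add_const a))) ?_
    exact HasCompactSupport.intro (isCompact_Icc (a := (-1 : ℝ)) (b := 1))
      fun x hx => by simp [tent_eq_zero hx]
  · have hlip : (tent x - tent (x + a)) ^ 2 ≤ a ^ 2 := by
      rw [sq_le_sq]
      refine (abs_tent_sub_le _ _).trans ?_
      rw [show x - (x + a) = -a by ring, abs_neg]
    simp only [ψ]
    by_cases h1 : x ∈ Set.Icc (-1 : ℝ) 1 <;> by_cases h2 : x + a ∈ Set.Icc (-1 : ℝ) 1
    · rw [Set.indicator_of_mem h1, Set.indicator_of_mem h2]; nlinarith [sq_nonneg a]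
    · rw [Set.indicator_of_mem h1, Set.indicator_of_notMem h2]; nlinarith
    · rw [Set.indicator_of_notMem h1, Set.indicator_of_mem h2]; nlinarith
    · rw [Set.indicator_of_notMem h1, Set.indicator_of_notMem h2, tent_eq_zero h1,
        tent_eq_zero h2]
      norm_num

/-- The probability measure on `ℝ` with density `3 / 2 * (tent x) ^ 2`. It is bounded, and the
square root of its density is Lipschitz. -/
noncomputable def tentLaw : Measure ℝ :=
  volume.withDensity fun x => ENNReal.ofReal (3 / 2 * tent x ^ 2)

theorem measurable_tent_density : Measurable fun x => ENNReal.ofReal (3 / 2 * tent x ^ 2) :=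
  ((continuous_tent.pow 2).const_mul _).measurable.ennreal_ofReal

instance : IsProbabilityMeasure tentLaw where
  measure_univ := by
    rw [tentLaw, withDensity_apply _ MeasurableSet.univ, Measure.restrict_univ,
      ← ofReal_integral_eq_lintegral_ofReal (integrable_tent_sq.const_mul _)
        (ae_of_all _ fun x => by positivity), integral_const_mul, integral_tent_sq]
    norm_num

theorem ae_tentLaw_abs_le : ∀ᵐ x ∂tentLaw, |x| ≤ 1 := by
  rw [tentLaw, ae_withDensity_iff measurable_tent_density]
  refine ae_of_all _ fun x hx => ?_
  by_contra h
  exact hx (by simp [tent_eq_zero (fun h' => h (abs_le.2 h') : x ∉ Set.Icc (-1 : ℝ) 1)])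

theorem integral_tentLaw_id : ∫ x, x ∂tentLaw = 0 := by
  have h : ∀ x, ENNReal.ofReal (3 / 2 * tent x ^ 2) < ∞ := fun x => ENNReal.ofReal_lt_top
  rw [tentLaw, integral_withDensity_eq_integral_toReal_smul measurable_tent_density
    (ae_of_all _ h)]
  have : ∀ x : ℝ, (ENNReal.ofReal (3 / 2 * tent (-x) ^ 2)).toReal • (-x)
      = -((ENNReal.ofReal (3 / 2 * tent x ^ 2)).toReal • x) := by
    intro x
    rw [show tent (-x) = tent x by simp [tent], smul_neg]
  have h2 := integral_neg_eq_self
    (fun x : ℝ => (ENNReal.ofReal (3 / 2 * tent x ^ 2)).toReal • x) volume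
  simp_rw [this, integral_neg] at h2
  linarith

theorem shiftAffinity_tentLaw : ShiftAffinity tentLaw fun a => ENNReal.ofReal (3 * a ^ 2) := by
  have hs : √(3 / 2 : ℝ) * √(3 / 2 : ℝ) = 3 / 2 := Real.mul_self_sqrt (by norm_num)
  refine ⟨fun x => Real.toNNReal (√(3 / 2) * tent x),
    (continuous_tent.const_mul _).measurable.real_toNNReal, ?_, fun a => ?_⟩
  · rw [tentLaw]
    congr 1
    ext x
    have h0 := tent_nonneg x
    rw [← ENNReal.ofReal, ← ENNReal.ofReal_pow (by positivity)]
    congr 1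
    rw [mul_pow, pow_two √(3 / 2), hs]
  · have : ∀ x, (Real.toNNReal (√(3 / 2) * tent x) : ℝ≥0∞)
        * (Real.toNNReal (√(3 / 2) * tent (x + a)) : ℝ≥0∞)
        = ENNReal.ofReal (3 / 2 * (tent x * tent (x + a))) := by
      intro x
      have h0 := tent_nonneg x
      rw [← ENNReal.ofReal, ← ENNReal.ofReal, ← ENNReal.ofReal_mul (by positivity)]
      congr 1
      linear_combination tent x * tent (x + a) * hs
    simp_rw [this]
    have hint : Integrable fun x => tent x * tent (x + a) := by
      refine Continuous.integrable_of_hasCompactSupport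
        (continuous_tent.mul (continuous_tent.comp (continuous_add_const a))) ?_
      exact HasCompactSupport.intro (isCompact_Icc (a := (-1 : ℝ)) (b := 1))
        fun x hx => by simp [tent_eq_zero hx]
    rw [← ofReal_integral_eq_lintegral_ofReal (hint.const_mul _)
      (ae_of_all _ fun x => by
        have := tent_nonneg x
        have := tent_nonneg (x + a)
        positivity), integral_const_mul, ← ENNReal.ofReal_one,
      ← ENNReal.ofReal_sub _ (by positivity)]
    refine ENNReal.ofReal_le_ofReal ?_
    linarith [integral_tent_mul_tent_ge a]

/-- Completing the square, `√(p x * p (x + a))` is a multiple of `p (x + a / 2)` for a centred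
Gaussian density `p`. -/
theorem shiftAffinity_gaussianReal {v : ℝ≥0} (hv : v ≠ 0) :
    ShiftAffinity (gaussianReal 0 v) fun a => ENNReal.ofReal (a ^ 2 / (8 * v)) := by
  refine ⟨fun x => Real.toNNReal √(gaussianPDFReal 0 v x),
    (measurable_gaussianPDFReal 0 v).sqrt.real_toNNReal, ?_, fun a => ?_⟩
  · rw [gaussianReal_of_var_ne_zero 0 hv]
    congr 1
    ext x
    rw [gaussianPDF, ← ENNReal.ofReal, ← ENNReal.ofReal_pow (by positivity),
      Real.sq_sqrt (gaussianPDFReal_nonneg 0 v x)]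
  · have hv' : (0 : ℝ) < v := by positivity
    have : ∀ x, (Real.toNNReal √(gaussianPDFReal 0 v x) : ℝ≥0∞)
        * (Real.toNNReal √(gaussianPDFReal 0 v (x + a)) : ℝ≥0∞)
        = ENNReal.ofReal (Real.exp (-(a ^ 2 / (8 * v))))
          * ENNReal.ofReal (gaussianPDFReal 0 v (x + a / 2)) := by
      intro x
      rw [← ENNReal.ofReal, ← ENNReal.ofReal, ← ENNReal.ofReal_mul (by positivity),
        ← ENNReal.ofReal_mul (by positivity), ← Real.sqrt_mul (gaussianPDFReal_nonneg 0 v x)]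
      congr 1
      rw [Real.sqrt_eq_iff_mul_self_eq
        (mul_nonneg (gaussianPDFReal_nonneg 0 v _) (gaussianPDFReal_nonneg 0 v _))
        (mul_nonneg (Real.exp_pos _).le (gaussianPDFReal_nonneg 0 v _))]
      simp only [gaussianPDFReal_def]
      have e1 : ∀ c A C : ℝ, Real.exp A * (c * Real.exp C) * (Real.exp A * (c * Real.exp C))
          = c * c * Real.exp (A + A + (C + C)) := by
        intro c A C; simp only [Real.exp_add]; ring
      have e2 : ∀ c A C : ℝ, c * Real.exp A * (c * Real.exp C) = c * c * Real.exp (A + C) := by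
        intro c A C; rw [Real.exp_add]; ring
      rw [e1, e2]
      congr 2
      field_simp
      ring
    simp_rw [this]
    rw [lintegral_const_mul _ (by fun_prop),
      lintegral_add_right_eq_self (fun x => ENNReal.ofReal (gaussianPDFReal 0 v x)) (a / 2),
      lintegral_gaussianPDFReal_eq_one 0 hv, mul_one, ← ENNReal.ofReal_one,
      ← ENNReal.ofReal_sub _ (by positivity)]
    refine ENNReal.ofReal_le_ofReal ?_
    linarith [Real.add_one_le_exp (-(a ^ 2 / (8 * (v : ℝ))))]

/-! ### Trading a common shift of the clients for a smaller one -/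

/-- A translation of the unobserved vector that all `K` clients share can be traded, as far as
the `ℓ` observed linear functionals can tell, for its projection to the orthogonal complement of
their common kernel. That complement has dimension at most `ℓ`, which bounds the projections of
the `d` coordinate directions on average. -/
theorem exists_equivalent_shifts {d K ℓ : ℕ} (A : Fin K → Matrix (Fin ℓ) (Fin d) ℝ) :
    ∃ w : Fin d → Fin K → Fin d → ℝ,
      (∀ i, ∑ k, (A k).mulVec (w i k) = ∑ k, (A k).mulVec (Pi.single i 1)) ∧
      ∑ i, ∑ k, ∑ j, w i k j ^ 2 ≤ K * ℓ := by
  classical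
  let E := EuclideanSpace ℝ (Fin K × Fin d)
  let Λ : E →ₗ[ℝ] (Fin ℓ → ℝ) :=
    ∑ k, (A k).mulVecLin ∘ₗ LinearMap.pi fun j =>
      (EuclideanSpace.proj (𝕜 := ℝ) (k, j) : E →L[ℝ] ℝ).toLinearMap
  have hΛ : ∀ x : E, Λ x = ∑ k, (A k).mulVec fun j => x (k, j) := by
    intro x
    simp only [Λ, LinearMap.sum_apply]
    rfl
  let S : Submodule ℝ E := (LinearMap.ker Λ)ᗮ
  have hS : Module.finrank ℝ S ≤ ℓ := by
    have h1 := (LinearMap.ker Λ).finrank_add_finrank_orthogonal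
    have h2 := LinearMap.finrank_range_add_finrank_ker Λ
    have h3 : Module.finrank ℝ (LinearMap.range Λ) ≤ ℓ := by
      simpa using Submodule.finrank_le (LinearMap.range Λ)
    change Module.finrank ℝ (LinearMap.ker Λ) + Module.finrank ℝ S = _ at h1
    omega
  let b := stdOrthonormalBasis ℝ S
  let e : Fin d → E := fun i => WithLp.toLp 2 fun p => if p.2 = i then 1 else 0
  have he : ∀ i k, (fun j => e i (k, j)) = Pi.single i (1 : ℝ) := by
    intro i k; ext j; simp [e, Pi.single_apply]
  refine ⟨fun i k j => (S.orthogonalProjectionOnto (e i) : E) (k, j), fun i => ?_, ?_⟩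
  · have h1 : e i - (S.orthogonalProjectionOnto (e i) : E) ∈ LinearMap.ker Λ := by
      have h0 := S.sub_starProjection_mem_orthogonal (e i)
      rwa [Submodule.orthogonal_orthogonal] at h0
    rw [LinearMap.mem_ker, map_sub, sub_eq_zero, hΛ, hΛ] at h1
    rw [← h1]
    simp_rw [he]
  · have hn : ∀ i, ∑ k, ∑ j, (S.orthogonalProjectionOnto (e i) : E) (k, j) ^ 2
        = ∑ m, (∑ k, (b m : E) (k, i)) ^ 2 := by
      intro i
      have h1 : ∑ k, ∑ j, (S.orthogonalProjectionOnto (e i) : E) (k, j) ^ 2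
          = ‖S.orthogonalProjectionOnto (e i)‖ ^ 2 := by
        rw [← Fintype.sum_prod_type' (f := fun k j =>
          (S.orthogonalProjectionOnto (e i) : E) (k, j) ^ 2), Submodule.coe_norm,
          EuclideanSpace.real_norm_sq_eq]
      rw [h1, ← b.sum_sq_norm_inner_right]
      refine Finset.sum_congr rfl fun m _ => ?_
      have h2 : inner ℝ (b m) (S.orthogonalProjectionOnto (e i)) = inner ℝ (b m : E) (e i) := by
        simp
      rw [h2, Real.norm_eq_abs, sq_abs, PiLp.inner_apply, Fintype.sum_prod_type]
      simp [e]
    simp_rw [hn]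
    rw [Finset.sum_comm]
    calc ∑ m, ∑ i, (∑ k, (b m : E) (k, i)) ^ 2
        ≤ ∑ m, ∑ i, (K : ℝ) * ∑ k, (b m : E) (k, i) ^ 2 := by
          gcongr with m _ i _
          simpa using sq_sum_le_card_mul_sum_sq (s := Finset.univ)
            (f := fun k => (b m : E) (k, i))
      _ = ∑ m, (K : ℝ) * ‖(b m : E)‖ ^ 2 := by
          refine Finset.sum_congr rfl fun m _ => ?_
          rw [← Finset.mul_sum, Finset.sum_comm, EuclideanSpace.real_norm_sq_eq,
            Fintype.sum_prod_type]
      _ = K * Module.finrank ℝ S := by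
          have h1 : ∀ m, ‖(b m : E)‖ = 1 := fun m => b.norm_eq_one m
          simp_rw [h1]
          simp [mul_comm]
      _ ≤ K * ℓ := by gcongr

/-! ### Linear objectives and the run of a protocol on them -/

/-- The law of the seed of a client: independent coordinates with the tent law. -/
noncomputable abbrev seedLaw (d : ℕ) : Measure (Fin d → ℝ) := Measure.pi fun _ => tentLaw

theorem integral_seedLaw_eval {d : ℕ} (i : Fin d) : ∫ ω, ω i ∂seedLaw d = 0 := by
  have h := measurePreserving_eval (fun _ : Fin d => tentLaw) i
  have h2 := integral_map (μ := seedLaw d) (φ := Function.eval i) (f := fun x : ℝ => x)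
    h.measurable.aemeasurable measurable_id.aestronglyMeasurable
  rw [h.map_eq, integral_tentLaw_id] at h2
  exact h2.symm

theorem ae_seedLaw_abs_le (d : ℕ) : ∀ᵐ ω ∂seedLaw d, ∀ i, |ω i| ≤ 1 := by
  rw [ae_all_iff]
  intro i
  exact (measurePreserving_eval (fun _ : Fin d => tentLaw) i).quasiMeasurePreserving.ae
    ae_tentLaw_abs_le

theorem norm_toLp_le {d : ℕ} {r : ℝ} (hr : 0 ≤ r) {ω : Fin d → ℝ} (h : ∀ i, |ω i| ≤ 1) :
    ‖(WithLp.toLp 2 (r • ω) : Vec d)‖ ≤ r * √d := by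
  rw [EuclideanSpace.norm_eq]
  refine Real.sqrt_le_iff.2 ⟨by positivity, ?_⟩
  rw [mul_pow, Real.sq_sqrt (Nat.cast_nonneg d)]
  calc ∑ i, ‖(r • ω) i‖ ^ 2 ≤ ∑ _i : Fin d, r ^ 2 := by
        gcongr with i
        rw [Pi.smul_apply, smul_eq_mul, norm_mul, Real.norm_eq_abs, Real.norm_eq_abs,
          abs_of_nonneg hr]
        exact mul_le_of_le_one_right hr (h i)
    _ = r ^ 2 * d := by simp [mul_comm]

theorem gradient_inner {d : ℕ} (v x : Vec d) : gradient (fun y : Vec d => inner ℝ v y) x = v := by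
  refine HasGradientAt.gradient ?_
  rw [hasGradientAt_iff_hasFDerivAt]
  exact (InnerProductSpace.toDual ℝ (Vec d) v).hasFDerivAt

/-- The problem of minimizing the linear function `⟨v, ·⟩` when every client returns the gradient
`v` plus noise with independent coordinates of size at most `r`, whatever the query point. With
`r = 0` the clients are exact. -/
@[reducible]
noncomputable def linearProblem {d : ℕ} (K : ℕ) {L σ B : ℝ} {X : Set (Vec d)} (hX : Convex ℝ X)
    (hL : 0 ≤ L) (v : Vec d) (r : ℝ) (hr : 0 ≤ r) (hσ : r * √d ≤ σ) (hB : ‖v‖ + r * √d ≤ B) :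
    Problem d K L σ B X where
  f := fun x => inner ℝ v x
  differentiableAt := fun x _ => (InnerProductSpace.toDual ℝ (Vec d) v).differentiableAt
  convexOn := by
    refine ⟨hX, fun x _ y _ a b _ _ _ => le_of_eq ?_⟩
    simp [inner_add_right, inner_smul_right]
  smooth := fun x _ y _ => by
    rw [gradient_inner, inner_sub_right]
    have : 0 ≤ L / 2 * ‖y - x‖ ^ 2 := by positivity
    linarith
  Seed := Fin d → ℝ
  μ := seedLaw d
  g := fun _ _ ω => v + WithLp.toLp 2 (r • ω)
  measurable_g := fun _ => by
    refine measurable_const.add ((PiLp.continuous_toLp 2 _).measurable.comp ?_)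
    exact measurable_snd.const_smul r
  unbiased := fun _ x _ => by
    have hm : Measurable fun ω : Fin d → ℝ => (WithLp.toLp 2 (r • ω) : Vec d) :=
      (PiLp.continuous_toLp 2 _).measurable.comp (measurable_id.const_smul r)
    have hi : Integrable (fun ω : Fin d → ℝ => (WithLp.toLp 2 (r • ω) : Vec d)) (seedLaw d) := by
      refine Integrable.of_bound hm.aestronglyMeasurable (r * √d) ?_
      filter_upwards [ae_seedLaw_abs_le d] with ω h
      exact norm_toLp_le hr h
    have h0 : ∫ ω : Fin d → ℝ, (WithLp.toLp 2 (r • ω) : Vec d) ∂seedLaw d = 0 := by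
      ext i
      have := (EuclideanSpace.proj (𝕜 := ℝ) i : Vec d →L[ℝ] ℝ).integral_comp_comm hi
      refine this.symm.trans ?_
      simp [integral_const_mul, integral_seedLaw_eval]
    rw [integral_add (integrable_const v) hi, h0, gradient_inner]
    simp
  deviation := fun _ x _ => by
    simp_rw [gradient_inner, add_sub_cancel_left]
    calc ∫ ω : Fin d → ℝ, ‖(WithLp.toLp 2 (r • ω) : Vec d)‖ ^ 2 ∂seedLaw d
        ≤ ∫ _ : Fin d → ℝ, σ ^ 2 ∂seedLaw d := by
          refine integral_mono_of_nonneg (ae_of_all _ fun _ => by positivity)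
            (integrable_const _) ?_
          filter_upwards [ae_seedLaw_abs_le d] with ω h
          have := (norm_toLp_le hr h).trans hσ
          exact pow_le_pow_left₀ (norm_nonneg _) this 2
      _ = σ ^ 2 := by simp
  bounded := fun _ x _ => by
    filter_upwards [ae_seedLaw_abs_le d] with ω h
    refine pow_le_pow_left₀ (norm_nonneg _) ?_ 2
    exact (norm_add_le _ _).trans ((add_le_add_right (norm_toLp_le hr h) _).trans hB)

section Run

variable {d K ℓ T : ℕ} {L P σ B : ℝ} {X : Set (Vec d)}

/-- If the clients ignore the query point, then the rounds do not interact. -/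
theorem decoded_eq_of_forall_eq (I : Problem d K L σ B X) (hI : ∀ k x y ω, I.g k x ω = I.g k y ω)
    (Q : CommScheme d K ℓ P σ B) (π : Algorithm d T X) (w : π.W) :
    ∀ (t : ℕ) (u : Fin t → Q.U) (ω : Fin t → Fin K → I.Seed) (z : Fin t → Fin ℓ → ℝ),
      decoded I Q π w t u ω z
        = fun i => Q.ψ (channelOutput I Q 0 (u i) (ω i) (z i)) (u i)
  | 0, _, _, _ => by ext i; exact i.elim0
  | t + 1, u, ω, z => by
    have hc : ∀ x, channelOutput I Q x (u (Fin.last t)) (ω (Fin.last t)) (z (Fin.last t))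
        = channelOutput I Q 0 (u (Fin.last t)) (ω (Fin.last t)) (z (Fin.last t)) := by
      intro x
      unfold channelOutput
      simp_rw [fun k => hI k x 0]
    funext i
    simp only [decoded]
    refine Fin.lastCases ?_ (fun i => ?_) i
    · rw [Fin.snoc_last, hc]
    · rw [Fin.snoc_castSucc, decoded_eq_of_forall_eq I hI Q π w t]

/-- The channel output in a round of `linearProblem`, with noise level `r`. -/
noncomputable def received (Q : CommScheme d K ℓ P σ B) (r : ℝ) (v : Vec d) (u : Q.U)
    (ω : Fin K → Fin d → ℝ) (z : Fin ℓ → ℝ) : Vec ℓ :=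
  WithLp.toLp 2 fun j => (∑ k, Q.φ k (v + WithLp.toLp 2 (r • ω k)) u j) + z j

/-- The output of the algorithm on `linearProblem`, as a function of all the randomness. -/
noncomputable def finalPoint (Q : CommScheme d K ℓ P σ B) (π : Algorithm d T X) (r : ℝ)
    (v : Vec d) (w : π.W) (u : ℕ → Q.U) (s : (Fin T → Fin K → Fin d → ℝ) × (Fin T → Fin ℓ → ℝ)) :
    Vec d :=
  π.output w fun t => Q.ψ (received Q r v (u t) (s.1 t) (s.2 t)) (u t)

theorem measurable_received (Q : CommScheme d K ℓ P σ B) (r : ℝ) (v : Vec d) :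
    Measurable fun p : Q.U × (Fin K → Fin d → ℝ) × (Fin ℓ → ℝ) =>
      received Q r v p.1 p.2.1 p.2.2 := by
  refine (PiLp.continuous_toLp 2 _).measurable.comp (measurable_pi_lambda _ fun j => ?_)
  refine Measurable.add (Finset.measurable_fun_sum _ fun k _ => ?_) (by fun_prop)
  have h1 : Measurable fun p : Q.U × (Fin K → Fin d → ℝ) × (Fin ℓ → ℝ) =>
      ((v + WithLp.toLp 2 (r • p.2.1 k) : Vec d), p.1) := by
    refine Measurable.prodMk (measurable_const.add ?_) measurable_fst
    refine (PiLp.continuous_toLp 2 _).measurable.comp (Measurable.const_smul ?_ r)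
    fun_prop
  have h2 := (Q.measurable_φ k).comp h1
  exact (EuclideanSpace.proj (𝕜 := ℝ) j : Vec ℓ →L[ℝ] ℝ).continuous.measurable.comp h2

theorem measurable_finalPoint (Q : CommScheme d K ℓ P σ B) (π : Algorithm d T X) (r : ℝ)
    (v : Vec d) :
    Measurable fun p : π.W × (ℕ → Q.U) ×
      ((Fin T → Fin K → Fin d → ℝ) × (Fin T → Fin ℓ → ℝ)) =>
        finalPoint Q π r v p.1 p.2.1 p.2.2 := by
  have h1 : ∀ t : Fin T, Measurable fun p : π.W × (ℕ → Q.U) ×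
      ((Fin T → Fin K → Fin d → ℝ) × (Fin T → Fin ℓ → ℝ)) =>
        (p.2.1 (t : ℕ), p.2.2.1 t, p.2.2.2 t) := fun t =>
    Measurable.prodMk (by fun_prop) (Measurable.prodMk (by fun_prop) (by fun_prop))
  have h2 : ∀ t : Fin T, Measurable fun p : π.W × (ℕ → Q.U) ×
      ((Fin T → Fin K → Fin d → ℝ) × (Fin T → Fin ℓ → ℝ)) =>
        (received Q r v (p.2.1 t) (p.2.2.1 t) (p.2.2.2 t), p.2.1 (t : ℕ)) := fun t =>
    ((measurable_received Q r v).comp (h1 t)).prodMk (measurable_fst.comp (h1 t))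
  have h3 : Measurable fun p : π.W × (ℕ → Q.U) ×
      ((Fin T → Fin K → Fin d → ℝ) × (Fin T → Fin ℓ → ℝ)) => (p.1, fun t : Fin T =>
        Q.ψ (received Q r v (p.2.1 t) (p.2.2.1 t) (p.2.2.2 t)) (p.2.1 t)) :=
    measurable_fst.prodMk (measurable_pi_lambda _ fun t => Q.measurable_ψ.comp (h2 t))
  exact π.measurable_output.comp h3

/-- For linear encoders, moving the gradient from `v` to `v'` has the same effect on the channel
output as a translation `(a, b)` of the noise with the same image. -/
theorem received_shift (Q : CommScheme d K ℓ P σ B)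
    (A : Fin K → Q.U → Matrix (Fin ℓ) (Fin d) ℝ)
    (hA : ∀ k x u, Q.φ k x u = WithLp.toLp 2 ((A k u).mulVec x.ofLp))
    (r : ℝ) {v v' : Vec d} (u : Q.U) (ω a : Fin K → Fin d → ℝ) (z b : Fin ℓ → ℝ)
    (h : r • ∑ k, (A k u).mulVec (a k) + b = ∑ k, (A k u).mulVec (v' - v).ofLp) :
    received Q r v' u ω z = received Q r v u (ω + a) (z + b) := by
  have h1 : ∀ k, (A k u).mulVec (v' + WithLp.toLp 2 (r • ω k)).ofLp
      = (A k u).mulVec (v + WithLp.toLp 2 (r • ω k)).ofLp + (A k u).mulVec (v' - v).ofLp := by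
    intro k
    rw [← Matrix.mulVec_add]
    congr 1
    ext j
    simp only [PiLp.add_apply, PiLp.sub_apply, Pi.add_apply]
    ring
  have h2 : ∀ k, (A k u).mulVec (v + WithLp.toLp 2 (r • (ω k + a k))).ofLp
      = (A k u).mulVec (v + WithLp.toLp 2 (r • ω k)).ofLp + r • (A k u).mulVec (a k) := by
    intro k
    rw [← Matrix.mulVec_smul, ← Matrix.mulVec_add]
    congr 1
    ext j
    simp only [PiLp.add_apply, Pi.add_apply, Pi.smul_apply, smul_eq_mul]
    ring
  unfold received
  congr 1
  ext j
  have hj := congrFun h j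
  simp only [hA, h1, h2, Pi.add_apply, Finset.sum_add_distrib, Finset.sum_apply, Pi.smul_apply,
    smul_eq_mul] at hj ⊢
  rw [← Finset.mul_sum]
  linarith

/-- The law of the gradient noise and the channel noise of a whole run. -/
noncomputable abbrev noiseLaw (d K ℓ T : ℕ) (σz : ℝ) :
    Measure ((Fin T → Fin K → Fin d → ℝ) × (Fin T → Fin ℓ → ℝ)) :=
  (Measure.pi fun _ : Fin T => Measure.pi fun _ : Fin K => seedLaw d).prod
    (Measure.pi fun _ : Fin T => Measure.pi fun _ : Fin ℓ =>
      gaussianReal 0 (Real.toNNReal (σz ^ 2)))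

theorem convergenceError_linearProblem (σz : ℝ) (hX : Convex ℝ X) (hL : 0 ≤ L) (v : Vec d) (r : ℝ)
    (hr : 0 ≤ r) (hσ : r * √d ≤ σ) (hB : ‖v‖ + r * √d ≤ B)
    (Q : CommScheme d K ℓ P σ B) (π : Algorithm d T X) :
    convergenceError σz (linearProblem K hX hL v r hr hσ hB) Q π
      = ∫⁻ p, ENNReal.ofReal (inner ℝ v (finalPoint Q π r v p.1 p.2.1 p.2.2)
          - sInf ((fun x => inner ℝ v x) '' X))
        ∂(π.ρ.prod (Q.ν.prod (noiseLaw d K ℓ T σz))) := by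
  unfold convergenceError
  refine lintegral_congr fun p => ?_
  rw [decoded_eq_of_forall_eq _ fun _ _ _ _ => rfl]
  rfl

end Run

/-! ### Assouad's lemma on the cube -/

/-- The cube `[-ρ, ρ]^d`. -/
def cube (d : ℕ) (ρ : ℝ) : Set (Vec d) := {x | ∀ i, |x i| ≤ ρ}

theorem convex_cube (d : ℕ) (ρ : ℝ) : Convex ℝ (cube d ρ) := by
  intro x hx y hy a b ha hb hab i
  calc |(a • x + b • y) i| = |a * x i + b * y i| := rfl
    _ ≤ |a * x i| + |b * y i| := abs_add_le _ _
    _ = a * |x i| + b * |y i| := by rw [abs_mul, abs_mul, abs_of_nonneg ha, abs_of_nonneg hb]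
    _ ≤ a * ρ + b * ρ := by gcongr; exacts [hx i, hy i]
    _ = ρ := by rw [← add_mul, hab, one_mul]

theorem norm_le_of_forall_abs_le {d : ℕ} {x : Vec d} {c : ℝ} (hc : 0 ≤ c) (h : ∀ i, |x i| ≤ c) :
    ‖x‖ ≤ c * √d := by
  rw [EuclideanSpace.norm_eq]
  refine Real.sqrt_le_iff.2 ⟨by positivity, ?_⟩
  rw [mul_pow, Real.sq_sqrt (Nat.cast_nonneg d)]
  calc ∑ i, ‖x i‖ ^ 2 ≤ ∑ _i : Fin d, c ^ 2 := by
        gcongr with i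
        exact h i
    _ = c ^ 2 * d := by simp [mul_comm]

theorem isAdmissibleDomain_cube {d : ℕ} {ρ D : ℝ} (hρ : 0 ≤ ρ) (hD : 2 * ρ * √d ≤ D) :
    IsAdmissibleDomain D (cube d ρ) where
  nonempty := ⟨0, fun i => by simpa using hρ⟩
  convex := convex_cube d ρ
  isCompact := by
    refine Metric.isCompact_of_isClosed_isBounded ?_ ?_
    · simp only [cube, Set.ofPred_forall]
      exact isClosed_iInter fun i => isClosed_le (by fun_prop) continuous_const
    · exact (Metric.isBounded_closedBall (x := (0 : Vec d)) (r := ρ * √d)).subset fun x hx => by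
        rw [mem_closedBall_zero_iff]
        exact norm_le_of_forall_abs_le hρ hx
  dist_le := fun x hx y hy => by
    rw [dist_eq_norm]
    refine (norm_le_of_forall_abs_le (by positivity) fun i => ?_).trans hD
    calc |(x - y) i| = |x i - y i| := rfl
      _ ≤ |x i| + |y i| := abs_sub _ _
      _ ≤ 2 * ρ := by linarith [hx i, hy i]

/-- The sign of a bit. -/
def boolSign (b : Bool) : ℝ := if b then 1 else -1

theorem boolSign_not (b : Bool) : boolSign (!b) = -boolSign b := by cases b <;> simp [boolSign]

theorem boolSign_mul_self (b : Bool) : boolSign b * boolSign b = 1 := by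
  cases b <;> simp [boolSign]

theorem abs_boolSign (b : Bool) : |boolSign b| = 1 := by cases b <;> simp [boolSign]

/-- The vertex of the cube `[-δ, δ]^d` with the signs `ε`. -/
noncomputable def signVec {d : ℕ} (δ : ℝ) (ε : Fin d → Bool) : Vec d :=
  WithLp.toLp 2 fun i => δ * boolSign (ε i)

theorem norm_signVec_le {d : ℕ} {δ : ℝ} (hδ : 0 ≤ δ) (ε : Fin d → Bool) :
    ‖signVec δ ε‖ ≤ δ * √d :=
  norm_le_of_forall_abs_le hδ fun i => by
    simp [signVec, abs_mul, abs_boolSign, abs_of_nonneg hδ]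

/-- Flip the bit `i`. -/
def flipBit {d : ℕ} (i : Fin d) (ε : Fin d → Bool) : Fin d → Bool :=
  Function.update ε i (!ε i)

theorem flipBit_involutive {d : ℕ} (i : Fin d) : Function.Involutive (flipBit i) := by
  intro ε
  simp [flipBit]

theorem signVec_flipBit_sub {d : ℕ} (δ : ℝ) (i : Fin d) (ε : Fin d → Bool) :
    (signVec δ (flipBit i ε) - signVec δ ε).ofLp
      = (-(2 * δ * boolSign (ε i))) • Pi.single i (1 : ℝ) := by
  ext j
  simp only [signVec, PiLp.sub_apply, Pi.smul_apply, smul_eq_mul]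
  by_cases h : j = i
  · subst h
    simp only [flipBit, Function.update_self, boolSign_not, Pi.single_eq_same]
    ring
  · simp [flipBit, Function.update_of_ne h, Pi.single_eq_of_ne h]

theorem inner_signVec {d : ℕ} (δ : ℝ) (ε : Fin d → Bool) (x : Vec d) :
    inner ℝ (signVec δ ε) x = ∑ i, δ * (boolSign (ε i) * x i) := by
  rw [PiLp.inner_apply]
  refine Finset.sum_congr rfl fun i _ => ?_
  simp [signVec]
  ring

theorem neg_le_inner_signVec {d : ℕ} {δ ρ : ℝ} (hδ : 0 ≤ δ) (ε : Fin d → Bool) {x : Vec d}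
    (hx : x ∈ cube d ρ) : -∑ _i : Fin d, δ * ρ ≤ inner ℝ (signVec δ ε) x := by
  rw [inner_signVec, ← Finset.sum_neg_distrib]
  refine Finset.sum_le_sum fun i _ => ?_
  have h1 : |boolSign (ε i) * x i| ≤ ρ := by
    rw [abs_mul, abs_boolSign, one_mul]
    exact hx i
  nlinarith [(abs_le.1 h1).1]

/-- On the cube, the suboptimality of `x` for the linear function with gradient `signVec δ ε` is
the sum over the coordinates `i` of `2 * δ * ρ` times the relative distance of `x i` from the
face where that coordinate is optimal. -/
theorem sum_le_inner_signVec_sub_sInf {d : ℕ} {δ ρ : ℝ} (hδ : 0 ≤ δ) (hρ : 0 < ρ)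
    (ε : Fin d → Bool) (x : Vec d) :
    2 * δ * ρ * ∑ i, (ρ + boolSign (ε i) * x i) / (2 * ρ)
      ≤ inner ℝ (signVec δ ε) x - sInf ((fun x => inner ℝ (signVec δ ε) x) '' cube d ρ) := by
  have h1 : sInf ((fun x => inner ℝ (signVec δ ε) x) '' cube d ρ) ≤ -∑ _i : Fin d, δ * ρ := by
    refine csInf_le ⟨-∑ _i : Fin d, δ * ρ, ?_⟩
      ⟨WithLp.toLp 2 fun i => -(ρ * boolSign (ε i)), fun i => ?_, ?_⟩
    · rintro _ ⟨y, hy, rfl⟩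
      exact neg_le_inner_signVec hδ ε hy
    · simp [abs_mul, abs_boolSign, abs_of_pos hρ]
    · simp only [inner_signVec, ← Finset.sum_neg_distrib]
      refine Finset.sum_congr rfl fun i _ => ?_
      linear_combination (-(δ * ρ)) * boolSign_mul_self (ε i)
  have h2 : 2 * δ * ρ * ∑ i, (ρ + boolSign (ε i) * x i) / (2 * ρ)
      = inner ℝ (signVec δ ε) x + ∑ _i : Fin d, δ * ρ := by
    rw [inner_signVec, Finset.mul_sum, ← Finset.sum_add_distrib]
    refine Finset.sum_congr rfl fun i _ => ?_
    field_simp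
    ring
  linarith

theorem sum_lintegral_prod_prod {α β γ ι κ : Type*} [MeasurableSpace α] [MeasurableSpace β]
    [MeasurableSpace γ] [Fintype ι] [Fintype κ] (μ : Measure α) (ν : Measure β) (η : Measure γ)
    [SFinite μ] [SFinite ν] [SFinite η] (F : ι → κ → α → β → γ → ℝ≥0∞)
    (hF : ∀ e i, Measurable fun p : α × β × γ => F e i p.1 p.2.1 p.2.2) :
    ∑ e, ∫⁻ p, ∑ i, F e i p.1 p.2.1 p.2.2 ∂(μ.prod (ν.prod η))
      = ∫⁻ x, ∫⁻ y, ∑ e, ∑ i, ∫⁻ z, F e i x y z ∂η ∂ν ∂μ := by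
  have h1 : Measurable fun p : α × β × γ => ∑ e, ∑ i, F e i p.1 p.2.1 p.2.2 :=
    Finset.measurable_fun_sum _ fun e _ => Finset.measurable_fun_sum _ fun i _ => hF e i
  rw [← lintegral_finsetSum _ fun e _ => Finset.measurable_fun_sum _ fun i _ => hF e i,
    lintegral_prod _ h1.aemeasurable]
  refine lintegral_congr fun x => ?_
  have h2 : Measurable fun q : β × γ => ∑ e, ∑ i, F e i x q.1 q.2 :=
    h1.comp measurable_prodMk_left
  rw [lintegral_prod _ h2.aemeasurable]
  refine lintegral_congr fun y => ?_
  have h3 : ∀ e i, Measurable fun z => F e i x y z := fun e i =>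
    (hF e i).comp (measurable_const.prodMk (measurable_const.prodMk measurable_id))
  rw [lintegral_finsetSum _ fun e _ => Finset.measurable_fun_sum _ fun i _ => h3 e i]
  exact Finset.sum_congr rfl fun e _ => lintegral_finsetSum _ fun i _ => h3 e i

section Assouad

variable {d K ℓ T : ℕ} {L P σ B : ℝ} {δ ρ r : ℝ}

/-- The relative distance of coordinate `i` of the output from its optimal value, when the
objective is the linear function with gradient `signVec δ ε`. -/
noncomputable def bitError (Q : CommScheme d K ℓ P σ B) (π : Algorithm d T (cube d ρ)) (δ r : ℝ)
    (ε : Fin d → Bool) (i : Fin d) (w : π.W) (u : ℕ → Q.U)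
    (s : (Fin T → Fin K → Fin d → ℝ) × (Fin T → Fin ℓ → ℝ)) : ℝ≥0∞ :=
  ENNReal.ofReal ((ρ + boolSign (ε i) * finalPoint Q π r (signVec δ ε) w u s i) / (2 * ρ))

theorem measurable_bitError (Q : CommScheme d K ℓ P σ B) (π : Algorithm d T (cube d ρ))
    (ε : Fin d → Bool) (i : Fin d) :
    Measurable fun p : π.W × (ℕ → Q.U) ×
      ((Fin T → Fin K → Fin d → ℝ) × (Fin T → Fin ℓ → ℝ)) =>
        bitError Q π δ r ε i p.1 p.2.1 p.2.2 := by
  have h1 := (EuclideanSpace.proj (𝕜 := ℝ) i : Vec d →L[ℝ] ℝ).continuous.measurable.comp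
    (measurable_finalPoint Q π r (signVec δ ε))
  exact (((h1.const_mul (boolSign (ε i))).const_add ρ).div_const (2 * ρ)).ennreal_ofReal

/-- `κ` bounds how well the flip of bit `i` can be detected when the public randomness is `u`:
the flip moves the gradient by `2 * δ` in direction `i`, and this has the same effect on the
received signals as a translation of the noise under which the noise law changes little. -/
def FlipHidden (Q : CommScheme d K ℓ P σ B) (A : Fin K → Q.U → Matrix (Fin ℓ) (Fin d) ℝ)
    (T : ℕ) (σz δ r : ℝ) (u : ℕ → Q.U) (i : Fin d) (κ : ℝ≥0∞) : Prop :=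
  ∀ c : ℝ, c ^ 2 = 4 * δ ^ 2 →
    ∃ s : (Fin T → Fin K → Fin d → ℝ) × (Fin T → Fin ℓ → ℝ),
      ShiftTesting (noiseLaw d K ℓ T σz) s κ ∧
      ∀ t : Fin T, r • ∑ k, (A k (u t)).mulVec (s.1 t k) + s.2 t
        = c • ∑ k, (A k (u t)).mulVec (Pi.single i 1)

/-- Seen from the sign vector `ε`, the bit errors of `ε` and of its flip are the two errors of one
test, evaluated under the noise law and under its translate. -/
theorem half_sub_le_bitError_add (Q : CommScheme d K ℓ P σ B)
    (A : Fin K → Q.U → Matrix (Fin ℓ) (Fin d) ℝ)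
    (hA : ∀ k x u, Q.φ k x u = WithLp.toLp 2 ((A k u).mulVec x.ofLp))
    (π : Algorithm d T (cube d ρ)) (hρ : 0 < ρ) {σz : ℝ} {u : ℕ → Q.U} {i : Fin d} {κ : ℝ≥0∞}
    (h : FlipHidden Q A T σz δ r u i κ) (w : π.W) (ε : Fin d → Bool) :
    1 / 2 - κ ≤ ∫⁻ s, bitError Q π δ r ε i w u s ∂noiseLaw d K ℓ T σz
      + ∫⁻ s, bitError Q π δ r (flipBit i ε) i w u s ∂noiseLaw d K ℓ T σz := by
  obtain ⟨a, ha, hs⟩ := h (-(2 * δ * boolSign (ε i))) (by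
    linear_combination 4 * δ ^ 2 * boolSign_mul_self (ε i))
  have hm : Measurable fun s => bitError Q π δ r ε i w u s :=
    (measurable_bitError Q π ε i).comp
      (measurable_const.prodMk (measurable_const.prodMk measurable_id))
  have hfp : Measurable fun s => finalPoint Q π r (signVec δ ε) w u s i :=
    (EuclideanSpace.proj (𝕜 := ℝ) i : Vec d →L[ℝ] ℝ).continuous.measurable.comp
      ((measurable_finalPoint Q π r (signVec δ ε)).comp
        (measurable_const.prodMk (measurable_const.prodMk measurable_id)))
  have hflip : ∀ s, bitError Q π δ r (flipBit i ε) i w u s = ENNReal.ofReal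
      ((ρ - boolSign (ε i) * finalPoint Q π r (signVec δ ε) w u (s + a) i) / (2 * ρ)) := by
    intro s
    have h1 : finalPoint Q π r (signVec δ (flipBit i ε)) w u s
        = finalPoint Q π r (signVec δ ε) w u (s + a) := by
      unfold finalPoint
      congr 1
      funext t
      rw [received_shift Q A hA r (v := signVec δ ε) (u t) (s.1 t) (a.1 t) (s.2 t) (a.2 t)]
      · rfl
      · rw [hs t, signVec_flipBit_sub, Finset.smul_sum]
        simp_rw [Matrix.mulVec_smul]
    unfold bitError
    rw [h1]
    congr 2
    simp only [flipBit, Function.update_self, boolSign_not]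
    ring
  simp_rw [hflip]
  refine ha _ (fun s => ENNReal.ofReal
      ((ρ - boolSign (ε i) * finalPoint Q π r (signVec δ ε) w u s i) / (2 * ρ))) hm
    (((hfp.const_mul _).const_sub ρ).div_const (2 * ρ)).ennreal_ofReal fun s => ?_
  have hb : |boolSign (ε i) * finalPoint Q π r (signVec δ ε) w u s i| ≤ ρ := by
    rw [abs_mul, abs_boolSign, one_mul]
    exact π.output_mem _ _ i
  obtain ⟨hb1, hb2⟩ := abs_le.1 hb
  unfold bitError
  rw [← ENNReal.ofReal_add (div_nonneg (by linarith) (by linarith))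
    (div_nonneg (by linarith) (by linarith)), ← ENNReal.ofReal_one]
  congr 1
  field_simp
  ring

/-- Assouad's lemma: if flips of the coordinates of the gradient are hidden on average, then some
linear objective on the cube has a large error. The bounds `κ` need not be measurable in the public
randomness, as they come from a choice of translations; only a measurable bound `κs` of their sum
is integrated. -/
theorem exists_le_convergenceError (hL : 0 ≤ L) (hδ : 0 ≤ δ) (hρ : 0 < ρ) (hr : 0 ≤ r)
    (hσ : r * √d ≤ σ) (hB : δ * √d + r * √d ≤ B) (Q : CommScheme d K ℓ P σ B)
    (A : Fin K → Q.U → Matrix (Fin ℓ) (Fin d) ℝ)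
    (hA : ∀ k x u, Q.φ k x u = WithLp.toLp 2 ((A k u).mulVec x.ofLp))
    (π : Algorithm d T (cube d ρ)) (σz : ℝ) (κ : (ℕ → Q.U) → Fin d → ℝ≥0∞)
    (hκ : ∀ u i, FlipHidden Q A T σz δ r u i (κ u i))
    (κs : (ℕ → Q.U) → ℝ≥0∞) (hκs : ∀ u, ∑ i, κ u i ≤ κs u) (hκm : Measurable κs)
    (hκint : ∫⁻ u, κs u ∂Q.ν ≤ d / 4) :
    ∃ I : Problem d K L σ B (cube d ρ),
      ENNReal.ofReal (δ * ρ * d / 4) ≤ convergenceError σz I Q π := by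
  let μ := noiseLaw d K ℓ T σz
  let avg : (Fin d → Bool) → ℝ≥0∞ := fun ε =>
    ∫⁻ p, ∑ i, bitError Q π δ r ε i p.1 p.2.1 p.2.2 ∂(π.ρ.prod (Q.ν.prod μ))
  -- The errors of a pair of sign vectors that differ in one bit are bounded together.
  have hpair : ∀ w u i, (Fintype.card (Fin d → Bool) : ℝ≥0∞) * (1 / 2 - κ u i)
      ≤ 2 * ∑ ε, ∫⁻ s, bitError Q π δ r ε i w u s ∂μ := by
    intro w u i
    have hswap : ∑ ε, ∫⁻ s, bitError Q π δ r (flipBit i ε) i w u s ∂μ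
        = ∑ ε, ∫⁻ s, bitError Q π δ r ε i w u s ∂μ :=
      Equiv.sum_comp (flipBit_involutive i).toPerm
        fun ε => ∫⁻ s, bitError Q π δ r ε i w u s ∂μ
    calc (Fintype.card (Fin d → Bool) : ℝ≥0∞) * (1 / 2 - κ u i)
        = ∑ _ε : Fin d → Bool, (1 / 2 - κ u i) := by simp
      _ ≤ ∑ ε, (∫⁻ s, bitError Q π δ r ε i w u s ∂μ
          + ∫⁻ s, bitError Q π δ r (flipBit i ε) i w u s ∂μ) :=
        Finset.sum_le_sum fun ε _ => half_sub_le_bitError_add Q A hA π hρ (hκ u i) w ε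
      _ = 2 * ∑ ε, ∫⁻ s, bitError Q π δ r ε i w u s ∂μ := by
        rw [Finset.sum_add_distrib, hswap, two_mul]
  have hsub : ∀ u, (d / 2 : ℝ≥0∞) - κs u ≤ ∑ i, (1 / 2 - κ u i) := by
    intro u
    refine (tsub_le_tsub_left (hκs u) _).trans ?_
    rw [tsub_le_iff_right, ← Finset.sum_add_distrib]
    calc (d / 2 : ℝ≥0∞) = ∑ _i : Fin d, (1 / 2 : ℝ≥0∞) := by simp [div_eq_mul_inv]
      _ ≤ _ := Finset.sum_le_sum fun i _ => le_tsub_add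
  have hsum : ∑ ε, avg ε
      = ∫⁻ w, ∫⁻ u, ∑ ε, ∑ i, ∫⁻ s, bitError Q π δ r ε i w u s ∂μ ∂Q.ν ∂π.ρ :=
    sum_lintegral_prod_prod π.ρ Q.ν μ (fun ε i w u s => bitError Q π δ r ε i w u s)
      fun ε i => measurable_bitError Q π ε i
  have hquarter : (d / 4 : ℝ≥0∞) + d / 4 = d / 2 := by
    rw [← ENNReal.add_halves (d / 2 : ℝ≥0∞), div_eq_mul_inv, div_eq_mul_inv, div_eq_mul_inv,
      mul_assoc, ← ENNReal.mul_inv (by simp) (by simp)]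
    norm_num
  have hlow : (d / 4 : ℝ≥0∞) ≤ ∫⁻ u, ((d / 2 : ℝ≥0∞) - κs u) ∂Q.ν := by
    refine le_trans ?_ (lintegral_sub_le _ _ hκm)
    rw [lintegral_const, measure_univ, mul_one, ← hquarter]
    refine le_trans ?_ (tsub_le_tsub_left hκint _)
    rw [ENNReal.add_sub_cancel_right (ENNReal.div_ne_top (by simp) (by simp))]
  have htot : (Fintype.card (Fin d → Bool) : ℝ≥0∞) * (d / 4) ≤ 2 * ∑ ε, avg ε := by
    rw [hsum]
    calc (Fintype.card (Fin d → Bool) : ℝ≥0∞) * (d / 4)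
        ≤ (Fintype.card (Fin d → Bool) : ℝ≥0∞)
          * ∫⁻ _w : π.W, ∫⁻ u, ((d / 2 : ℝ≥0∞) - κs u) ∂Q.ν ∂π.ρ := by
          gcongr
          simpa using hlow
      _ ≤ ∫⁻ _w : π.W, ∫⁻ u, (Fintype.card (Fin d → Bool) : ℝ≥0∞)
          * ((d / 2 : ℝ≥0∞) - κs u) ∂Q.ν ∂π.ρ := by
          rw [← lintegral_const_mul' _ _ (by simp)]
          refine lintegral_mono fun w => ?_
          rw [← lintegral_const_mul' _ _ (by simp)]
      _ ≤ ∫⁻ w, ∫⁻ u, 2 * ∑ ε, ∑ i, ∫⁻ s, bitError Q π δ r ε i w u s ∂μ ∂Q.ν ∂π.ρ := by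
          refine lintegral_mono fun w => lintegral_mono fun u => ?_
          calc _ ≤ (Fintype.card (Fin d → Bool) : ℝ≥0∞) * ∑ i, (1 / 2 - κ u i) := by
                gcongr
                exact hsub u
            _ ≤ ∑ i, 2 * ∑ ε, ∫⁻ s, bitError Q π δ r ε i w u s ∂μ := by
                rw [Finset.mul_sum]
                exact Finset.sum_le_sum fun i _ => hpair w u i
            _ = _ := by rw [← Finset.mul_sum, Finset.sum_comm]
      _ = _ := by
          rw [← lintegral_const_mul' _ _ (by simp)]
          refine lintegral_congr fun w => ?_
          rw [← lintegral_const_mul' _ _ (by simp)]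
  -- Some sign vector is at least as bad as the average one.
  obtain ⟨ε, -, hε⟩ : ∃ ε ∈ (Finset.univ : Finset (Fin d → Bool)), (d / 4 : ℝ≥0∞) ≤ 2 * avg ε := by
    by_contra! hcon
    have : ∑ ε, 2 * avg ε < ∑ _ε : Fin d → Bool, (d / 4 : ℝ≥0∞) :=
      ENNReal.sum_lt_sum_of_nonempty Finset.univ_nonempty hcon
    rw [← Finset.mul_sum, Finset.sum_const, nsmul_eq_mul, Finset.card_univ] at this
    exact absurd htot (not_le.2 this)
  refine ⟨linearProblem K (convex_cube d ρ) hL (signVec δ ε) r hr hσ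
    ((add_le_add_left (norm_signVec_le hδ ε) _).trans hB), ?_⟩
  rw [convergenceError_linearProblem]
  calc ENNReal.ofReal (δ * ρ * d / 4) = ENNReal.ofReal (δ * ρ) * (d / 4) := by
        rw [mul_div_assoc, ENNReal.ofReal_mul (by positivity),
          ENNReal.ofReal_div_of_pos (by norm_num)]
        simp
    _ ≤ ENNReal.ofReal (δ * ρ) * (2 * avg ε) := by gcongr
    _ = ENNReal.ofReal (2 * δ * ρ) * avg ε := by
        rw [← mul_assoc, mul_comm _ (2 : ℝ≥0∞), mul_assoc 2 δ ρ,
          ENNReal.ofReal_mul (p := 2) (by norm_num)]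
        simp
    _ = ∫⁻ p, ENNReal.ofReal (2 * δ * ρ) * ∑ i, bitError Q π δ r ε i p.1 p.2.1 p.2.2
          ∂(π.ρ.prod (Q.ν.prod μ)) := by
        rw [lintegral_const_mul' _ _ ENNReal.ofReal_ne_top]
    _ ≤ _ := by
        refine lintegral_mono fun p => ?_
        refine le_trans (le_of_eq ?_) (ENNReal.ofReal_le_ofReal
          (sum_le_inner_signVec_sub_sInf hδ hρ ε (finalPoint Q π r (signVec δ ε) p.1 p.2.1 p.2.2)))
        rw [ENNReal.ofReal_mul (p := 2 * δ * ρ) (by positivity), ENNReal.ofReal_sum_of_nonneg]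
        · rfl
        · intro i _
          have hb : |boolSign (ε i) * finalPoint Q π r (signVec δ ε) p.1 p.2.1 p.2.2 i| ≤ ρ := by
            rw [abs_mul, abs_boolSign, one_mul]
            exact π.output_mem _ _ i
          exact div_nonneg (by linarith [(abs_le.1 hb).1]) (by linarith)

end Assouad

/-! ### The two lower bounds and their combination -/

section Instances

variable {d K ℓ T : ℕ} {L P σ B : ℝ} {δ ρ r : ℝ}

/-- The error forced by the noise of the gradient estimates alone. -/
theorem exists_le_convergenceError_of_gradientNoise (hL : 0 ≤ L) (hδ : 0 ≤ δ) (hρ : 0 < ρ)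
    (hr : 0 < r) (hσ : r * √d ≤ σ) (hB : δ * √d + r * √d ≤ B) (Q : CommScheme d K ℓ P σ B)
    (hQ : Q.IsAnalog) (π : Algorithm d T (cube d ρ)) (σz : ℝ)
    (h : 12 * δ ^ 2 / r ^ 2 * (K * (T * ℓ)) ≤ d / 4) :
    ∃ I : Problem d K L σ B (cube d ρ),
      ENNReal.ofReal (δ * ρ * d / 4) ≤ convergenceError σz I Q π := by
  obtain ⟨-, A, hA⟩ := hQ
  choose w hw hwle using fun u : Q.U => exists_equivalent_shifts fun k => A k u
  refine exists_le_convergenceError hL hδ hρ hr.le hσ hB Q A hA π σz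
    (fun u i => ∑ t : Fin T, ∑ k, ∑ j, ENNReal.ofReal (12 * δ ^ 2 / r ^ 2 * w (u t) i k j ^ 2))
    (fun u i c hc => ⟨(fun t k => (c / r) • w (u t) i k, 0), ?_, fun t => ?_⟩)
    (fun _ => d / 4) (fun u => ?_) measurable_const (by simp)
  · have : (volume : Measure (Fin T → Fin K → Fin d → ℝ)).IsAddRightInvariant := by
      have : (volume : Measure (Fin K → Fin d → ℝ)).IsAddLeftInvariant := inferInstance
      have : (volume : Measure (Fin T → Fin K → Fin d → ℝ)).IsAddLeftInvariant := inferInstance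
      infer_instance
    have haff := (((shiftAffinity_tentLaw.pi d).pi K).pi T).shiftTesting
      fun t k => (c / r) • w (u t) i k
    have hcoef : ∀ x : ℝ, 3 * ((c / r) * x) ^ 2 = 12 * δ ^ 2 / r ^ 2 * x ^ 2 := by
      intro x
      rw [mul_pow, div_pow, hc]; ring
    simp only [Pi.smul_apply, smul_eq_mul, hcoef] at haff
    exact haff.prod_left
  · rw [← hw (u t) i, Finset.smul_sum, Finset.smul_sum]
    simp only [Matrix.mulVec_smul, Pi.zero_apply, add_zero, smul_smul]
    rw [mul_div_cancel₀ c hr.ne']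
  · have hnn : ∀ x : ℝ, 0 ≤ 12 * δ ^ 2 / r ^ 2 * x ^ 2 := fun x => by positivity
    simp_rw [← ENNReal.ofReal_sum_of_nonneg fun j _ => hnn _]
    have h1 : ∀ t : Fin T, ∀ i, ∑ k, ENNReal.ofReal (∑ j, 12 * δ ^ 2 / r ^ 2 * w (u t) i k j ^ 2)
        = ENNReal.ofReal (∑ k, ∑ j, 12 * δ ^ 2 / r ^ 2 * w (u t) i k j ^ 2) := fun t i =>
      (ENNReal.ofReal_sum_of_nonneg fun k _ => Finset.sum_nonneg fun j _ => hnn _).symm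
    simp_rw [h1]
    rw [Finset.sum_comm]
    calc ∑ t : Fin T, ∑ i, ENNReal.ofReal (∑ k, ∑ j, 12 * δ ^ 2 / r ^ 2 * w (u t) i k j ^ 2)
        = ∑ t : Fin T, ENNReal.ofReal
          (∑ i, ∑ k, ∑ j, 12 * δ ^ 2 / r ^ 2 * w (u t) i k j ^ 2) :=
          Finset.sum_congr rfl fun t _ => (ENNReal.ofReal_sum_of_nonneg fun i _ =>
            Finset.sum_nonneg fun k _ => Finset.sum_nonneg fun j _ => hnn _).symm
      _ ≤ ∑ _t : Fin T, ENNReal.ofReal (12 * δ ^ 2 / r ^ 2 * (K * ℓ)) := by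
          refine Finset.sum_le_sum fun t _ => ENNReal.ofReal_le_ofReal ?_
          simp_rw [← Finset.mul_sum]
          exact mul_le_mul_of_nonneg_left (hwle (u t)) (by positivity)
      _ = ENNReal.ofReal (12 * δ ^ 2 / r ^ 2 * (K * (T * ℓ))) := by
          rw [← ENNReal.ofReal_sum_of_nonneg fun _ _ => by positivity]
          simp only [Finset.sum_const, Finset.card_univ, Fintype.card_fin, nsmul_eq_mul]
          congr 1
          ring
      _ ≤ ENNReal.ofReal (d / 4) := ENNReal.ofReal_le_ofReal h
      _ = d / 4 := by
          rw [ENNReal.ofReal_div_of_pos (by norm_num)]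
          simp

theorem isEstimateLaw_dirac {x : Vec d} (hx : ‖x‖ ≤ B) : IsEstimateLaw σ B (Measure.dirac x) where
  isProbabilityMeasure := inferInstance
  bounded := by
    rw [ae_dirac_eq]
    exact pow_le_pow_left₀ (norm_nonneg x) hx 2
  deviation := by simpa using sq_nonneg σ

/-- The power constraint for a deterministic gradient estimate, which is an admissible one. -/
theorem lintegral_norm_encoder_sq_le (Q : CommScheme d K ℓ P σ B) (k : Fin K) (t : ℕ) {x : Vec d}
    (hx : ‖x‖ ≤ B) :
    ∫⁻ u, ENNReal.ofReal (‖Q.φ k x (u t)‖ ^ 2) ∂Q.ν ≤ ENNReal.ofReal (ℓ * P) := by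
  have h := Q.power k t _ (isEstimateLaw_dirac hx)
  have hm : Measurable fun p : Vec d × (ℕ → Q.U) =>
      ENNReal.ofReal (‖Q.φ k p.1 (p.2 t)‖ ^ 2) := by
    have h1 : Measurable fun p : Vec d × (ℕ → Q.U) => (p.1, p.2 t) := by fun_prop
    exact ((((Q.measurable_φ k).comp h1).norm).pow_const 2).ennreal_ofReal
  rwa [Measure.dirac_prod, lintegral_map hm measurable_prodMk_left] at h

/-- The error forced by the channel noise alone. The clients are exact here, and the power
constraint limits the strength of the signal that reaches the server. -/
theorem exists_le_convergenceError_of_channelNoise (hL : 0 ≤ L) (hδ : 0 ≤ δ) (hρ : 0 < ρ)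
    (hσ : 0 < σ) (hσB : σ ≤ B) (hB : δ * √d ≤ B) (Q : CommScheme d K ℓ P σ B)
    (hQ : Q.IsAnalog) (π : Algorithm d T (cube d ρ)) {σz : ℝ} (hz : 0 < σz)
    (h : δ ^ 2 * K ^ 2 * P / (2 * σz ^ 2 * σ ^ 2) * (T * ℓ) ≤ 1 / 4) :
    ∃ I : Problem d K L σ B (cube d ρ),
      ENNReal.ofReal (δ * ρ * d / 4) ≤ convergenceError σz I Q π := by
  obtain ⟨-, A, hA⟩ := hQ
  have hv : Real.toNNReal (σz ^ 2) ≠ 0 := by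
    rw [ne_eq, Real.toNNReal_eq_zero, not_le]; positivity
  have hvc : ((Real.toNNReal (σz ^ 2) : ℝ≥0) : ℝ) = σz ^ 2 := Real.coe_toNNReal _ (by positivity)
  let C : ℝ := δ ^ 2 * K / (2 * σz ^ 2 * σ ^ 2)
  have hC : 0 ≤ C := by positivity
  let e : Fin d → Vec d := fun i => EuclideanSpace.single i σ
  have he : ∀ i, ‖e i‖ ≤ B := fun i => by
    simpa [e, abs_of_pos hσ] using hσB
  have hAe : ∀ k u i j, Q.φ k (e i) u j = σ * (A k u).mulVec (Pi.single i 1) j := by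
    intro k u i j
    have : (e i).ofLp = σ • Pi.single i (1 : ℝ) := by
      ext m
      simp [e, Pi.single_apply]
    rw [hA, this, Matrix.mulVec_smul]
    rfl
  have hmφ : ∀ k i (t : ℕ), Measurable fun u : ℕ → Q.U =>
      ENNReal.ofReal (‖Q.φ k (e i) (u t)‖ ^ 2) := by
    intro k i t
    have h1 : Measurable fun u : ℕ → Q.U => (e i, u t) := by fun_prop
    exact ((((Q.measurable_φ k).comp h1).norm).pow_const 2).ennreal_ofReal
  refine exists_le_convergenceError hL hδ hρ le_rfl (by simpa using hσ.le) (by simpa using hB)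
    Q A hA π σz
    (fun u i => ∑ t : Fin T, ∑ j, ENNReal.ofReal
      (δ ^ 2 / (2 * σz ^ 2) * ((∑ k, (A k (u t)).mulVec (Pi.single i 1)) j) ^ 2))
    (fun u i c hc => ⟨(0, fun t => c • ∑ k, (A k (u t)).mulVec (Pi.single i 1)), ?_,
      fun t => by simp⟩)
    (fun u => ∑ i, ∑ t : Fin T, ENNReal.ofReal C *
      ∑ k, ENNReal.ofReal (‖Q.φ k (e i) (u t)‖ ^ 2)) (fun u => ?_) ?_ ?_
  · have haff := (((shiftAffinity_gaussianReal hv).pi ℓ).pi T).shiftTesting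
      fun t => c • ∑ k, (A k (u t)).mulVec (Pi.single i 1)
    have hcoef : ∀ x : ℝ, (c * x) ^ 2 / (8 * σz ^ 2) = δ ^ 2 / (2 * σz ^ 2) * x ^ 2 := by
      intro x
      rw [mul_pow, hc]
      field_simp
      ring
    simp only [Pi.smul_apply, smul_eq_mul, hvc, hcoef] at haff
    exact haff.prod_right
  · refine Finset.sum_le_sum fun i _ => Finset.sum_le_sum fun t _ => ?_
    rw [← ENNReal.ofReal_sum_of_nonneg fun j _ => by positivity,
      ← ENNReal.ofReal_sum_of_nonneg fun k _ => by positivity, ← ENNReal.ofReal_mul hC]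
    refine ENNReal.ofReal_le_ofReal ?_
    calc ∑ j, δ ^ 2 / (2 * σz ^ 2) * ((∑ k, (A k (u t)).mulVec (Pi.single i 1)) j) ^ 2
        ≤ ∑ j, δ ^ 2 / (2 * σz ^ 2)
          * (K * ∑ k, ((A k (u t)).mulVec (Pi.single i 1) j) ^ 2) := by
          gcongr with j _
          rw [Finset.sum_apply]
          simpa using sq_sum_le_card_mul_sum_sq (s := Finset.univ)
            (f := fun k => (A k (u t)).mulVec (Pi.single i 1) j)
      _ = C * ∑ k, ‖Q.φ k (e i) (u t)‖ ^ 2 := by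
          simp_rw [EuclideanSpace.real_norm_sq_eq, hAe, mul_pow, ← Finset.mul_sum]
          rw [Finset.sum_comm]
          simp only [C]
          field_simp
  · exact Finset.measurable_fun_sum _ fun i _ => Finset.measurable_fun_sum _ fun t _ =>
      (Finset.measurable_fun_sum _ fun k _ => hmφ k i t).const_mul _
  · have hmt : ∀ i (t : Fin T), Measurable fun u : ℕ → Q.U => ENNReal.ofReal C *
        ∑ k, ENNReal.ofReal (‖Q.φ k (e i) (u t)‖ ^ 2) := fun i t =>
      (Finset.measurable_fun_sum _ fun k _ => hmφ k i t).const_mul _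
    have hms : ∀ i, Measurable fun u : ℕ → Q.U => ∑ t : Fin T, ENNReal.ofReal C *
        ∑ k, ENNReal.ofReal (‖Q.φ k (e i) (u t)‖ ^ 2) := fun i =>
      Finset.measurable_fun_sum _ fun t _ => hmt i t
    rw [lintegral_finsetSum _ fun i _ => hms i]
    calc ∑ i, ∫⁻ u, ∑ t : Fin T, ENNReal.ofReal C *
          ∑ k, ENNReal.ofReal (‖Q.φ k (e i) (u t)‖ ^ 2) ∂Q.ν
        ≤ ∑ _i : Fin d, ∑ _t : Fin T, ENNReal.ofReal C * ∑ _k : Fin K, ENNReal.ofReal (ℓ * P) := by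
          refine Finset.sum_le_sum fun i _ => ?_
          rw [lintegral_finsetSum _ fun t _ => hmt i t]
          refine Finset.sum_le_sum fun t _ => ?_
          rw [lintegral_const_mul _ (Finset.measurable_fun_sum _ fun k _ => hmφ k i t),
            lintegral_finsetSum _ fun k _ => hmφ k i t]
          gcongr with k
          exact lintegral_norm_encoder_sq_le Q k t (he i)
      _ = d * ENNReal.ofReal (δ ^ 2 * K ^ 2 * P / (2 * σz ^ 2 * σ ^ 2) * (T * ℓ)) := by
          simp only [Finset.sum_const, Finset.card_univ, Fintype.card_fin, nsmul_eq_mul]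
          congr 1
          rw [← ENNReal.ofReal_natCast T, ← ENNReal.ofReal_natCast K,
            ← ENNReal.ofReal_mul (by positivity), ← ENNReal.ofReal_mul hC,
            ← ENNReal.ofReal_mul (by positivity)]
          congr 1
          simp only [C]
          field_simp
      _ ≤ d * ENNReal.ofReal (1 / 4) := by gcongr
      _ = d / 4 := by
          rw [ENNReal.ofReal_div_of_pos (by norm_num), div_eq_mul_inv, div_eq_mul_inv]
          simp

end Instances

/-- The minimax bound. Up to a factor `2`, the sum `σ ^ 2 + σ ^ 2 / SNR` is the larger of its two
terms: the first one is due to the gradient noise, the second one to the channel noise. -/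
theorem ofReal_le_analogMinimaxError {d K N : ℕ} {L σ B D P σz : ℝ} (hd : 0 < d) (hK : 0 < K)
    (hL : 0 ≤ L) (hσ : 0 < σ) (hσB : σ ≤ B) (hD : 0 < D) (hP : 0 < P) (hz : 0 < σz)
    (hN : ((d : ℝ) / K) * (σ ^ 2 + σ ^ 2 / snr K P σz) / B ^ 2 ≤ N) :
    ENNReal.ofReal (1 / 250 * D / √((K : ℝ) * N) * √(d * σ ^ 2 + d * σ ^ 2 / snr K P σz))
      ≤ analogMinimaxError d K N L σ B D P σz := by
  have hd' : (0 : ℝ) < d := by exact_mod_cast hd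
  have hK' : (0 : ℝ) < K := by exact_mod_cast hK
  have hB : 0 < B := hσ.trans_le hσB
  have hsd : 0 < √(d : ℝ) := Real.sqrt_pos.2 hd'
  have hsd2 : √(d : ℝ) * √d = d := Real.mul_self_sqrt hd'.le
  set S := snr K P σz with hSdef
  have hS : 0 < S := by rw [hSdef, snr]; positivity
  set g := σ ^ 2 + σ ^ 2 / S with hg
  have hg0 : 0 < g := by positivity
  have hN' : (0 : ℝ) < N := lt_of_lt_of_le (by positivity) hN
  have hKN : 0 < (K : ℝ) * N := by positivity
  have hdg : d * g ≤ K * N * B ^ 2 := by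
    rw [div_le_iff₀ (by positivity), div_mul_eq_mul_div, div_le_iff₀ hK'] at hN
    linarith
  set ρ := D / (2 * √d) with hρdef
  have hρ : 0 < ρ := by positivity
  have hρD : 2 * ρ * √d = D := by
    rw [hρdef]; field_simp
  -- It suffices to hide gradients with coordinates of size `δ` for some `δ ^ 2` of order
  -- `g / (K N)`. The constants are such that `√800 ≤ 30` and `30 / 250 ≤ 1 / 8`.
  have key : ∀ δ : ℝ, 0 ≤ δ → g ≤ 800 * (K * N) * δ ^ 2 →
      (∀ (ℓ T : ℕ), T * ℓ ≤ N → ∀ Q : CommScheme d K ℓ P σ B, Q.IsAnalog →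
        ∀ π : Algorithm d T (cube d ρ), ∃ I : Problem d K L σ B (cube d ρ),
          ENNReal.ofReal (δ * ρ * d / 4) ≤ convergenceError σz I Q π) →
      ENNReal.ofReal (1 / 250 * D / √((K : ℝ) * N) * √(d * σ ^ 2 + d * σ ^ 2 / S))
        ≤ analogMinimaxError d K N L σ B D P σz := by
    intro δ hδ hgδ hI
    have hnum : 1 / 250 * D / √((K : ℝ) * N) * √(d * σ ^ 2 + d * σ ^ 2 / S) ≤ δ * ρ * d / 4 := by
      have h1 : √(d * σ ^ 2 + d * σ ^ 2 / S) ≤ 30 * (√((K : ℝ) * N) * δ * √d) := by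
        refine Real.sqrt_le_iff.2 ⟨by positivity, ?_⟩
        rw [mul_pow, mul_pow, mul_pow, Real.sq_sqrt hKN.le, Real.sq_sqrt hd'.le,
          show d * σ ^ 2 + d * σ ^ 2 / S = g * d by rw [hg]; ring]
        nlinarith [mul_le_mul_of_nonneg_right hgδ hd'.le,
          mul_nonneg (mul_nonneg hKN.le (sq_nonneg δ)) hd'.le]
      have h2 : 0 < √((K : ℝ) * N) := Real.sqrt_pos.2 hKN
      calc 1 / 250 * D / √((K : ℝ) * N) * √(d * σ ^ 2 + d * σ ^ 2 / S)
          ≤ 1 / 250 * D / √((K : ℝ) * N) * (30 * (√((K : ℝ) * N) * δ * √d)) := by gcongr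
        _ = 30 / 250 * (D * δ * √d) := by field_simp
        _ ≤ 1 / 8 * (D * δ * √d) := mul_le_mul_of_nonneg_right (by norm_num) (by positivity)
        _ = δ * ρ * d / 4 := by
          linear_combination (-(1 / 8) * δ * √d) * hρD + 1 / 4 * δ * ρ * hsd2
    refine (ENNReal.ofReal_le_ofReal hnum).trans ?_
    refine le_trans ?_ (le_iSup₂_of_le (cube d ρ) (isAdmissibleDomain_cube hρ.le hρD.le) le_rfl)
    unfold analogErrorOn
    refine le_iInf fun ℓ => le_iInf fun T => le_iInf fun hT => le_iInf fun Q => le_iInf fun hQ =>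
      le_iInf fun π => ?_
    obtain ⟨I, h⟩ := hI ℓ T hT Q hQ π
    exact le_iSup_of_le I h
  -- The lower bound on `N` leaves room for such gradients, and for noise of norm `B / 2`.
  have hsmall : ∀ δ : ℝ, 0 ≤ δ → 400 * (K * N) * δ ^ 2 ≤ g → δ * √d ≤ B / 2 := by
    intro δ hδ h
    refine abs_le_of_sq_le_sq' ?_ (by positivity) |>.2
    rw [mul_pow, Real.sq_sqrt hd'.le]
    have h1 : 400 * (δ ^ 2 * d) * (K * N) ≤ B ^ 2 * (K * N) := by
      nlinarith [mul_le_mul_of_nonneg_right h hd'.le]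
    have h2 := le_of_mul_le_mul_right h1 hKN
    nlinarith [mul_nonneg (sq_nonneg δ) hd'.le]
  have hTN : ∀ {ℓ T : ℕ}, T * ℓ ≤ N → (T : ℝ) * ℓ ≤ N := fun h => by exact_mod_cast h
  rcases le_total 1 S with h1 | h1
  · -- The gradient noise dominates.
    obtain ⟨δ, hδ0, hδ2⟩ : ∃ δ : ℝ, 0 ≤ δ ∧ δ ^ 2 * (400 * (K * N)) = σ ^ 2 := by
      refine ⟨σ / (20 * √(K * N)), by positivity, ?_⟩
      rw [div_pow, mul_pow, Real.sq_sqrt hKN.le]; field_simp; norm_num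
    have hg1 : σ ^ 2 / S ≤ σ ^ 2 := div_le_self (by positivity) h1
    have hg2 : 0 ≤ σ ^ 2 / S := by positivity
    refine key δ hδ0 (by linarith) fun ℓ T hT Q hQ π => ?_
    have hrd : σ / (2 * √d) * √d = σ / 2 := by field_simp
    refine exists_le_convergenceError_of_gradientNoise hL hδ0 hρ (r := σ / (2 * √d))
      (by positivity) (by rw [hrd]; linarith) ?_ Q hQ π σz ?_
    · rw [hrd]
      linarith [hsmall δ hδ0 (by linarith)]
    · have hr2 : 12 * δ ^ 2 / (σ / (2 * √d)) ^ 2 = 48 * d * δ ^ 2 / σ ^ 2 := by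
        rw [div_pow, mul_pow, Real.sq_sqrt hd'.le]; field_simp; ring
      rw [hr2]
      calc 48 * d * δ ^ 2 / σ ^ 2 * (K * (T * ℓ)) ≤ 48 * d * δ ^ 2 / σ ^ 2 * (K * N) := by
            gcongr; exact hTN hT
        _ = 48 / 400 * d * (δ ^ 2 * (400 * (K * N))) / σ ^ 2 := by ring
        _ = 48 / 400 * d := by rw [hδ2]; field_simp
        _ ≤ d / 4 := by linarith
  · -- The channel noise dominates.
    obtain ⟨δ, hδ0, hδ2⟩ : ∃ δ : ℝ, 0 ≤ δ ∧ δ ^ 2 * (400 * (K * N)) = σ ^ 2 / S := by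
      refine ⟨σ / (20 * √(K * N * S)), by positivity, ?_⟩
      rw [div_pow, mul_pow, Real.sq_sqrt (by positivity)]; field_simp; norm_num
    have hg1 : σ ^ 2 ≤ σ ^ 2 / S := le_div_self (by positivity) hS h1
    refine key δ hδ0 (by linarith) fun ℓ T hT Q hQ π => ?_
    refine exists_le_convergenceError_of_channelNoise hL hδ0 hρ hσ hσB ?_ Q hQ π hz ?_
    · linarith [hsmall δ hδ0 (by linarith [sq_nonneg σ])]
    · calc δ ^ 2 * K ^ 2 * P / (2 * σz ^ 2 * σ ^ 2) * (T * ℓ)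
          ≤ δ ^ 2 * K ^ 2 * P / (2 * σz ^ 2 * σ ^ 2) * N := by gcongr; exact hTN hT
        _ = (δ ^ 2 * (400 * (K * N))) * S / (800 * σ ^ 2) := by
          rw [hSdef, snr]; field_simp; ring
        _ = 1 / 800 := by rw [hδ2]; field_simp
        _ ≤ 1 / 4 := by norm_num

end OTA

theorem theorem5p1 :
    ∃ c : ℝ, 0 < c ∧ c < 1 ∧
      ∀ (d K N : ℕ) (L σ B D P σz : ℝ), 0 < d → 0 < K → 0 ≤ L → 0 < σ → σ ≤ B → 0 < D →
        0 < P → 0 < σz →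
        ((d : ℝ) / K) * (σ ^ 2 + σ ^ 2 / OTA.snr K P σz) / B ^ 2 ≤ N →
        ENNReal.ofReal
            (c * D / √((K : ℝ) * N) * √(d * σ ^ 2 + d * σ ^ 2 / OTA.snr K P σz))
          ≤ OTA.analogMinimaxError d K N L σ B D P σz ∧
        ENNReal.ofReal (√(d : ℝ) * (c * (D * σ / √((K : ℝ) * N))))
          ≤ OTA.analogMinimaxError d K N L σ B D P σz := by
  refine ⟨1 / 250, by norm_num, by norm_num, ?_⟩
  intro d K N L σ B D P σz hd hK hL hσ hσB hD hP hz hN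
  have h := OTA.ofReal_le_analogMinimaxError hd hK hL hσ hσB hD hP hz hN
  refine ⟨h, (ENNReal.ofReal_le_ofReal ?_).trans h⟩
  have hS : 0 ≤ OTA.snr K P σz := by unfold OTA.snr; positivity
  have h1 : √(d : ℝ) * σ ≤ √(d * σ ^ 2 + d * σ ^ 2 / OTA.snr K P σz) := by
    refine Real.le_sqrt_of_sq_le ?_
    rw [mul_pow, Real.sq_sqrt (Nat.cast_nonneg d)]
    exact le_add_of_nonneg_right (by positivity)
  calc √(d : ℝ) * (1 / 250 * (D * σ / √((K : ℝ) * N)))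
      = 1 / 250 * D / √((K : ℝ) * N) * (√(d : ℝ) * σ) := by ring
    _ ≤ _ := by gcongr
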